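/- Let $M$ be a Riemann surface with complex structure $I$, let $m_0\in M$, and let $(g,\nabla)$ be a special Kähler structure on $M\setminus\{m_0\}$: $g$ is a smooth Hermitian metric with Kähler form $\omega=g(I\cdot,\cdot)$, and $\nabla$ is a smooth flat torsion-free connection on the tangent bundle with $\nabla\omega=0$ and $(\nabla_XI)Y=(\nabla_YI)X$ for all $X,Y$. Let $z$ be a holomorphic coordinate on a neighbourhood of $m_0$ with $z(m_0)=0$, and write $g=w\,|dz|^2$. Let $\Xi=-\omega(\pi^{(1,0)},\nabla\pi^{(1,0)})=\Xi_0\,dz^3$ be the associated holomorphic cubic form, where $\pi^{(1,0)}$ is the projection of the complexified tangent bundle onto its $(1,0)$-part, and assume that $\Xi_0$ is meromorphic at $m_0$ of finite order $n\in\mathbb Z$. Let $\beta\in\mathbb R$ be the exponent of the singularity, that is, for some constant $C>0$ and as $z\to0$, either $$\beta<n+1\quad\text{and}\quad w=|z|^{\beta}\,(C+o(1)),$$ or $$\beta=n+1\quad\text{and}\quad w=-|z|^{n+1}\log|z|\,(C+o(1)).$$ Let $r>0$ be such that the closed disc $\{|z|\le r\}$ is contained in the image of the coordinate, and let $\mathrm{Hol}(S^1,\nabla)$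 be the holonomy of $\nabla$ along the circle $t\mapsto re^{it}$, $0\le t\le 2\pi$, an endomorphism of the tangent space at the point $z=r$. Then the following are equivalent: 1. there is a basis $(e,f)$ of this tangent space with $\omega(e,f)=1$ in which the matrix of $\mathrm{Hol}(S^1,\nabla)$ lies in $\mathrm{Sp}(2,\mathbb Z)$, i.e. $\mathrm{Hol}(S^1,\nabla)$ is conjugate in $\mathrm{Sp}(2,\mathbb R)$ to a matrix in $\mathrm{Sp}(2,\mathbb Z)$; 2. there is a basis of this tangent space in which the matrix of $\mathrm{Hol}(S^1,\nabla)$ lies in $\mathrm{Sp}(2,\mathbb Z)$, i.e. $\mathrm{Hol}(S^1,\nabla)$ is conjugate in $\mathrm{GL}(2,\mathbb R)$ to a matrix in $\mathrm{Sp}(2,\mathbb Z)$; 3. $\beta\in\frac12\mathbb Z\cup\frac13\mathbb Z$; 4. $\cos\pi\beta\in\{0,\pm\frac12,\pm1\}$. -/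

import Mathlib

open Set Filter Topology
open scoped Manifold ContDiff

noncomputable section

/-! ### Linear ordinary differential equations, for parallel transport -/

/-- Truncation of the real and imaginary parts to `[-R, R]`. -/
def truncate (R : ℝ) (x : ℂ) : ℂ := ⟨max (-R) (min R x.re), max (-R) (min R x.im)⟩

theorem abs_clamp_sub_le (R a b : ℝ) :
    |max (-R) (min R a) - max (-R) (min R b)| ≤ |a - b| := by
  have h1 := abs_max_sub_max_le_max (-R) (min R a) (-R) (min R b)
  have h2 := abs_min_sub_min_le_max R a R b
  have h3 : ∀ x y : ℝ, max |x - x| |y| = |y| := fun x y => by simp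
  exact (h1.trans_eq (h3 _ _)).trans (h2.trans_eq (h3 _ _))

theorem norm_truncate_sub_le (R : ℝ) (x y : ℂ) :
    ‖truncate R x - truncate R y‖ ≤ 2 * ‖x - y‖ := by
  have h := Complex.norm_le_abs_re_add_abs_im (truncate R x - truncate R y)
  have h1 : |(truncate R x - truncate R y).re| ≤ |(x - y).re| := by
    simpa [truncate] using abs_clamp_sub_le R x.re y.re
  have h2 : |(truncate R x - truncate R y).im| ≤ |(x - y).im| := by
    simpa [truncate] using abs_clamp_sub_le R x.im y.im
  linarith [Complex.abs_re_le_norm (x - y), Complex.abs_im_le_norm (x - y)]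

theorem norm_truncate_le (R : ℝ) (hR : 0 ≤ R) (x : ℂ) : ‖truncate R x‖ ≤ 2 * R := by
  have h := Complex.norm_le_abs_re_add_abs_im (truncate R x)
  have h1 : |(truncate R x).re| ≤ R := by
    rw [abs_le]
    exact ⟨le_max_left _ _, max_le (by linarith) (min_le_left _ _)⟩
  have h2 : |(truncate R x).im| ≤ R := by
    rw [abs_le]
    exact ⟨le_max_left _ _, max_le (by linarith) (min_le_left _ _)⟩
  linarith

theorem truncate_of_norm_le {R : ℝ} {x : ℂ} (h : ‖x‖ ≤ R) : truncate R x = x := by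
  have h1 := abs_le.1 ((Complex.abs_re_le_norm x).trans h)
  have h2 := abs_le.1 ((Complex.abs_im_le_norm x).trans h)
  apply Complex.ext <;> simp [truncate, *]

/-- `Y` solves the linear equation `Y' = B Y` on `[0, T]`. -/
def SolvesLinear (B : ℝ → ℂ →L[ℝ] ℂ) (T : ℝ) (Y : ℝ → ℂ) : Prop :=
  ∀ t ∈ Icc 0 T, HasDerivWithinAt Y (B t (Y t)) (Icc 0 T) t

theorem SolvesLinear.unique {B : ℝ → ℂ →L[ℝ] ℂ} {T : ℝ} (hT : 0 ≤ T)
    (hB : ContinuousOn B (Icc 0 T)) {Y Z : ℝ → ℂ} (hY : SolvesLinear B T Y)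
    (hZ : SolvesLinear B T Z) (h0 : Y 0 = Z 0) : Y T = Z T := by
  obtain ⟨K, hK⟩ := isCompact_Icc.exists_bound_of_continuousOn hB
  have hd : ∀ {W : ℝ → ℂ}, SolvesLinear B T W → ∀ t ∈ Ico 0 T,
      HasDerivWithinAt W (B t (W t)) (Ici t) t := fun {W} hW t ht =>
    (hW t (Ico_subset_Icc_self ht)).mono_of_mem_nhdsWithin
      (mem_of_superset (Icc_mem_nhdsGE ht.2) (Icc_subset_Icc_left ht.1))
  refine ODE_solution_unique_of_mem_Icc_right (v := fun t x => B t x) (s := fun _ => univ)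
    (K := ⟨max K 0, le_max_right _ _⟩) (a := 0) (b := T) ?_
    (fun t ht => (hY t ht).continuousWithinAt) (hd hY) (fun _ _ => mem_univ _)
    (fun t ht => (hZ t ht).continuousWithinAt) (hd hZ) (fun _ _ => mem_univ _) h0
    (right_mem_Icc.2 hT)
  intro t ht
  refine ((B t).lipschitz.weaken ?_).lipschitzOnWith
  exact (hK t (Ico_subset_Icc_self ht)).trans (le_max_left _ _)

theorem SolvesLinear.exists {B : ℝ → ℂ →L[ℝ] ℂ} {T : ℝ} (hT : 0 ≤ T)
    (hB : ContinuousOn B (Icc 0 T)) (v : ℂ) : ∃ Y, Y 0 = v ∧ SolvesLinear B T Y := by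
  obtain ⟨K', hK'⟩ := isCompact_Icc.exists_bound_of_continuousOn hB
  set K := max K' 0 with hKdef
  have hK0 : 0 ≤ K := le_max_right _ _
  have hK : ∀ t ∈ Icc 0 T, ‖B t‖ ≤ K := fun t ht => (hK' t ht).trans (le_max_left _ _)
  set R := ‖v‖ * Real.exp (K * 2 * T) with hR
  have hR0 : 0 ≤ R := by positivity
  have hPL : IsPicardLindelof (fun t x => B t (truncate R x)) (tmin := 0) (tmax := T)
      ⟨0, left_mem_Icc.2 hT⟩ v ⟨K * (2 * R) * T, by positivity⟩ 0
      ⟨K * (2 * R), by positivity⟩ ⟨K * 2, by positivity⟩ := by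
    refine ⟨fun t ht => ?_, fun x _ => ?_, fun t ht x _ => ?_, ?_⟩
    · refine (LipschitzWith.of_dist_le_mul fun x y => ?_).lipschitzOnWith
      rw [dist_eq_norm, dist_eq_norm, ← map_sub]
      calc _ ≤ ‖B t‖ * ‖truncate R x - truncate R y‖ := (B t).le_opNorm _
        _ ≤ K * (2 * ‖x - y‖) :=
          mul_le_mul (hK t ht) (norm_truncate_sub_le R x y) (norm_nonneg _) hK0
        _ = K * 2 * ‖x - y‖ := by ring
    · exact hB.clm_apply continuousOn_const
    · calc _ ≤ ‖B t‖ * ‖truncate R x‖ := (B t).le_opNorm _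
        _ ≤ K * (2 * R) :=
          mul_le_mul (hK t ht) (norm_truncate_le R hR0 x) (norm_nonneg _) hK0
    · simp only [sub_zero, NNReal.coe_zero, max_eq_left hT]
      exact le_rfl
  obtain ⟨Y, hY0, hY⟩ := hPL.exists_eq_forall_mem_Icc_hasDerivWithinAt₀
  refine ⟨Y, hY0, fun t ht => ?_⟩
  have hbound := norm_le_gronwallBound_of_norm_deriv_right_le (f := Y)
    (f' := fun t => B t (truncate R (Y t))) (δ := ‖v‖) (K := K * 2) (ε := 0) (a := 0) (b := T)
    (fun t ht => (hY t ht).continuousWithinAt)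
    (fun t ht => (hY t (Ico_subset_Icc_self ht)).mono_of_mem_nhdsWithin
      (mem_of_superset (Icc_mem_nhdsGE ht.2) (Icc_subset_Icc_left ht.1)))
    (by rw [show Y 0 = v from hY0])
    (fun t ht => by
      have h0 : truncate R 0 = 0 := truncate_of_norm_le (by simpa using hR0)
      have h2 := norm_truncate_sub_le R (Y t) 0
      rw [h0, sub_zero, sub_zero] at h2
      calc _ ≤ ‖B t‖ * ‖truncate R (Y t)‖ := (B t).le_opNorm _
        _ ≤ K * (2 * ‖Y t‖) :=
          mul_le_mul (hK t (Ico_subset_Icc_self ht)) h2 (norm_nonneg _) hK0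
        _ = K * 2 * ‖Y t‖ + 0 := by ring) t ht
  rw [gronwallBound_ε0, sub_zero] at hbound
  have hle : ‖Y t‖ ≤ R := hbound.trans (by
    rw [hR]
    gcongr
    exact ht.2)
  have := hY t ht
  rwa [truncate_of_norm_le hle] at this

/-- The time-`T` solution map `Y 0 ↦ Y T` of the linear equation `Y' = B Y`. -/
def solutionMap (B : ℝ → ℂ →L[ℝ] ℂ) (T : ℝ) (hT : 0 ≤ T) (hB : ContinuousOn B (Icc 0 T)) :
    ℂ →ₗ[ℝ] ℂ where
  toFun v := (SolvesLinear.exists hT hB v).choose T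
  map_add' v w := by
    have hv := (SolvesLinear.exists hT hB v).choose_spec
    have hw := (SolvesLinear.exists hT hB w).choose_spec
    have hvw := (SolvesLinear.exists hT hB (v + w)).choose_spec
    refine SolvesLinear.unique hT hB hvw.2 (Z := _ + _) (fun t ht => ?_) (by
      rw [hvw.1, Pi.add_apply, hv.1, hw.1])
    rw [Pi.add_apply, map_add]
    exact (hv.2 t ht).add (hw.2 t ht)
  map_smul' c v := by
    have hv := (SolvesLinear.exists hT hB v).choose_spec
    have hcv := (SolvesLinear.exists hT hB (c • v)).choose_spec
    refine SolvesLinear.unique hT hB hcv.2 (Z := c • _) (fun t ht => ?_) (by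
      rw [hcv.1, Pi.smul_apply, hv.1])
    rw [Pi.smul_apply, map_smul]
    exact (hv.2 t ht).const_smul c

theorem solutionMap_apply {B : ℝ → ℂ →L[ℝ] ℂ} {T : ℝ} (hT : 0 ≤ T)
    (hB : ContinuousOn B (Icc 0 T)) {Y : ℝ → ℂ} (hY : SolvesLinear B T Y) :
    solutionMap B T hT hB (Y 0) = Y T :=
  have h := (SolvesLinear.exists hT hB (Y 0)).choose_spec
  SolvesLinear.unique hT hB h.2 hY h.1

/-! ### Special Kähler structures in a holomorphic coordinate -/

/-- The two-form `g(I ·, ·)` at a point, where `I` is multiplication by `i`. -/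
def fundamentalForm (g : ℂ →L[ℝ] ℂ →L[ℝ] ℝ) : ℂ →L[ℝ] ℂ →L[ℝ] ℝ :=
  g ∘L (ContinuousLinearMap.mul ℝ ℂ Complex.I)

/-- The vector `(∇_X I) Y` for the connection `d + Γ`, `∇_X Y = D_X Y + Γ(X) Y`, at a point. -/
def covDerivI (Γ : ℂ →L[ℝ] ℂ →L[ℝ] ℂ) (X Y : ℂ) : ℂ :=
  Γ X (Complex.I * Y) - Complex.I * Γ X Y

/-- A special Kähler structure on an open set `U ⊆ ℂ` with its standard complex structure:
a metric `g` and a connection `∇ = d + Γ` on the tangent bundle, trivialized by the coordinate.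
Tangent vectors are elements of `ℂ`, viewed as a real vector space; values outside `U` carry no
meaning. Closedness of `g(I ·, ·)` is automatic in real dimension two. -/
structure LocalSpecialKahler (U : Set ℂ) where
  g : ℂ → ℂ →L[ℝ] ℂ →L[ℝ] ℝ
  Γ : ℂ → ℂ →L[ℝ] ℂ →L[ℝ] ℂ
  g_smooth : ContDiffOn ℝ ∞ g U
  Γ_smooth : ContDiffOn ℝ ∞ Γ U
  g_symm : ∀ p ∈ U, ∀ X Y, g p X Y = g p Y X
  g_pos : ∀ p ∈ U, ∀ X, X ≠ 0 → 0 < g p X X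
  /-- `g` is Hermitian: `I` is an isometry. -/
  g_hermitian : ∀ p ∈ U, ∀ X Y, g p (Complex.I * X) (Complex.I * Y) = g p X Y
  torsion_free : ∀ p ∈ U, ∀ X Y, Γ p X Y = Γ p Y X
  /-- The curvature `R(X, Y) Z` vanishes. -/
  flat : ∀ p ∈ U, ∀ X Y Z,
    fderiv ℝ Γ p X Y Z - fderiv ℝ Γ p Y X Z + Γ p X (Γ p Y Z) - Γ p Y (Γ p X Z) = 0
  /-- `∇` preserves `g(I ·, ·)`. -/
  symplectic : ∀ p ∈ U, ∀ X Y Z,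
    fderiv ℝ (fun q => fundamentalForm (g q)) p X Y Z =
      fundamentalForm (g p) (Γ p X Y) Z + fundamentalForm (g p) Y (Γ p X Z)
  /-- `(∇_X I) Y = (∇_Y I) X`. -/
  special : ∀ p ∈ U, ∀ X Y, covDerivI (Γ p) X Y = covDerivI (Γ p) Y X

namespace LocalSpecialKahler

variable {U : Set ℂ} (S : LocalSpecialKahler U)

/-- The conformal factor `w` in `g = w |dz|²`. -/
def conformalFactor (p : ℂ) : ℝ := S.g p 1 1

/-- The Kähler form `g(I ·, ·)` at `p`. -/
def kahlerForm (p : ℂ) : ℂ →L[ℝ] ℂ →L[ℝ] ℝ := fundamentalForm (S.g p)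

/-- The complex bilinear extension of the Kähler form to the complexified tangent space; the
pair `(a, b)` stands for the complexified vector `a ⊗ 1 + b ⊗ √-1`. -/
def kahlerFormC (p : ℂ) (V W : ℂ × ℂ) : ℂ :=
  ⟨S.kahlerForm p V.1 W.1 - S.kahlerForm p V.2 W.2,
    S.kahlerForm p V.1 W.2 + S.kahlerForm p V.2 W.1⟩

/-- The projection `π^{(1,0)} X = (X - √-1 I X) / 2` of a real tangent vector. -/
def projOneZero (X : ℂ) : ℂ × ℂ := ((2 : ℝ)⁻¹ • X, -((2 : ℝ)⁻¹ • (Complex.I * X)))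

/-- `(∇_X π^{(1,0)}) Y = -(√-1 / 2) (∇_X I) Y`. -/
def covDerivProj (p X Y : ℂ) : ℂ × ℂ := (0, -((2 : ℝ)⁻¹ • covDerivI (S.Γ p) X Y))

/-- The holomorphic cubic form `Ξ = -ω(π^{(1,0)}, ∇ π^{(1,0)})` on real tangent vectors. -/
def cubicForm (p X Y Z : ℂ) : ℂ :=
  -S.kahlerFormC p (projOneZero X) (S.covDerivProj p Y Z)

/-- The coefficient `Ξ₀` in `Ξ = Ξ₀ dz³`, that is, the value of `Ξ` on `(∂ₓ, ∂ₓ, ∂ₓ)`. -/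
def cubicCoeff (p : ℂ) : ℂ := S.cubicForm p 1 1 1

/-- The holomorphic cubic form has the finite order `n` at the origin. -/
def CubicOrderEq (n : ℤ) : Prop :=
  MeromorphicAt S.cubicCoeff 0 ∧ meromorphicOrderAt S.cubicCoeff 0 = (n : WithTop ℤ)

/-- The exponent `β` of the singularity at the origin, if the cubic form has order `n` there:
`β < n + 1` and `w = |z|^β (C + o(1))`, or `β = n + 1` and `w = -|z|^(n+1) log|z| (C + o(1))`,
with a constant `C > 0`. -/
def SingularExponent (n : ℤ) (β : ℝ) : Prop :=
  ∃ C : ℝ, 0 < C ∧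
    ((β < n + 1 ∧
        Tendsto (fun p : ℂ => S.conformalFactor p / ‖p‖ ^ β) (𝓝[≠] 0) (𝓝 C)) ∨
      (β = n + 1 ∧
        Tendsto (fun p : ℂ => S.conformalFactor p / (-(‖p‖ ^ (n + 1) * Real.log ‖p‖)))
          (𝓝[≠] 0) (𝓝 C)))

/-- The coefficient of the equation `Y' = -Γ(γ') Y` of parallel vector fields along the circle
`γ(t) = r e^{it}`. -/
def circleCoeff (r t : ℝ) : ℂ →L[ℝ] ℂ := -S.Γ (circleMap 0 r t) (deriv (circleMap 0 r) t)

theorem continuousOn_circleCoeff {r : ℝ} (h : ∀ t, circleMap 0 r t ∈ U) :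
    ContinuousOn (S.circleCoeff r) (Icc 0 (2 * Real.pi)) := by
  have h1 : Continuous fun t => S.Γ (circleMap 0 r t) :=
    S.Γ_smooth.continuousOn.comp_continuous (continuous_circleMap 0 r) h
  have h2 : Continuous (deriv (circleMap 0 r)) := by
    have : deriv (circleMap 0 r) = fun t => circleMap 0 r t * Complex.I := by
      funext t
      simp
    rw [this]
    fun_prop
  exact (h1.clm_apply h2).neg.continuousOn

/-- The holonomy of `∇` along the circle `t ↦ r e^{it}`, `0 ≤ t ≤ 2π`: the endomorphism
`Y 0 ↦ Y (2π)` of the tangent space at the point `r`, for parallel `Y` along the circle. -/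
def holonomy (r : ℝ) (h : ∀ t, circleMap 0 r t ∈ U) : ℂ →ₗ[ℝ] ℂ :=
  solutionMap (S.circleCoeff r) (2 * Real.pi) Real.two_pi_pos.le (S.continuousOn_circleCoeff h)

end LocalSpecialKahler

/-! ### Special Kähler structures on Riemann surfaces -/

/-- A special Kähler structure on an open subset `V` of a Riemann surface `M`: in every
holomorphic coordinate a structure as above, where the metrics and the connections correspond
to each other under the (holomorphic) changes of coordinates. -/
structure SpecialKahlerStructure (M : Type*) [TopologicalSpace M] [ChartedSpace ℂ M]
    (V : Set M) where
  inChart : ∀ e ∈ IsManifold.maximalAtlas 𝓘(ℂ) ω M,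
    LocalSpecialKahler (e.target ∩ e.symm ⁻¹' V)
  metric_change : ∀ e (he : e ∈ IsManifold.maximalAtlas 𝓘(ℂ) ω M) e'
    (he' : e' ∈ IsManifold.maximalAtlas 𝓘(ℂ) ω M) (p : ℂ),
    p ∈ (e.symm.trans e').source → e.symm p ∈ V → ∀ X Y,
      (inChart e he).g p X Y =
        (inChart e' he').g (e' (e.symm p))
          (deriv (e' ∘ e.symm) p * X) (deriv (e' ∘ e.symm) p * Y)
  connection_change : ∀ e (he : e ∈ IsManifold.maximalAtlas 𝓘(ℂ) ω M) e'
    (he' : e' ∈ IsManifold.maximalAtlas 𝓘(ℂ) ω M) (p : ℂ),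
    p ∈ (e.symm.trans e').source → e.symm p ∈ V → ∀ X Y,
      deriv (e' ∘ e.symm) p * (inChart e he).Γ p X Y =
        (inChart e' he').Γ (e' (e.symm p))
          (deriv (e' ∘ e.symm) p * X) (deriv (e' ∘ e.symm) p * Y) +
        deriv (deriv (e' ∘ e.symm)) p * X * Y

/-- The circles in a coordinate disc centred at `m₀` lie in the complement of `m₀`. -/
theorem circle_mem_punctured {M : Type*} [TopologicalSpace M] {m₀ : M}
    {z : OpenPartialHomeomorph M ℂ} (hz : z m₀ = 0) {r : ℝ} (hr : 0 < r)
    (hball : Metric.closedBall 0 r ⊆ z.target) (t : ℝ) :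
    circleMap 0 r t ∈ z.target ∩ z.symm ⁻¹' {m₀}ᶜ := by
  have ht : circleMap 0 r t ∈ z.target :=
    hball (Metric.sphere_subset_closedBall (circleMap_mem_sphere 0 hr.le t))
  refine ⟨ht, fun h => ?_⟩
  have h' : z.symm (circleMap 0 r t) = m₀ := h
  have h0 : circleMap 0 r t = 0 := by rw [← z.right_inv ht, h', hz]
  exact circleMap_ne_center hr.ne' h0

/-! ### Conjugacy to integral symplectic matrices -/

/-- The matrix of `P` in some basis lies in `Sp(2, ℤ)`. -/
def IsConjToIntegral (P : ℂ →ₗ[ℝ] ℂ) : Prop :=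
  ∃ b : Module.Basis (Fin 1 ⊕ Fin 1) ℝ ℂ, ∃ N ∈ Matrix.symplecticGroup (Fin 1) ℤ,
    LinearMap.toMatrix b b P = N.map (Int.cast : ℤ → ℝ)

/-- The matrix of `P` in some symplectic basis, for the symplectic form `σ`, lies in
`Sp(2, ℤ)`. -/
def IsSymplecticallyConjToIntegral (σ : ℂ →L[ℝ] ℂ →L[ℝ] ℝ) (P : ℂ →ₗ[ℝ] ℂ) : Prop :=
  ∃ b : Module.Basis (Fin 1 ⊕ Fin 1) ℝ ℂ, σ (b (Sum.inl 0)) (b (Sum.inr 0)) = 1 ∧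
    ∃ N ∈ Matrix.symplecticGroup (Fin 1) ℤ,
      LinearMap.toMatrix b b P = N.map (Int.cast : ℤ → ℝ)

end

/-!
In a coordinate the connection is `Γ(X) Y = a X Y + c X̄ Ȳ`, where `d log w = 2 Re (a dz)` because
`∇ω = 0`, and `‖c‖ w = 2 ‖Ξ₀‖`. Flatness, written in polar coordinates, is a zero-curvature
equation, so the derivative of the holonomy in the radius `s` is a commutator and its trace does not
depend on `s`.

As `s → 0`, the asymptotics of `w` and `Ξ₀` give `s ‖c‖ → 0`, so that the antilinear part of the
connection drops out and the holonomy is asymptotically the rotation by `-θ(s)`, where `i θ(s)` is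
the integral of `a dz` over the circle. This angle is `π s` times the derivative of the circle
average of `log w`. Since `log w / log ‖z‖ → β`, the mean value theorem makes `π β` a cluster value
of `θ` at `0`, and the trace of the holonomy is `2 cos (π β)`.

Finally, an area-preserving endomorphism of a plane is conjugate to an integral symplectic matrix,
by a symplectic change of basis, as soon as its trace is an integer.
-/

section AlternatingPlane

variable {K V : Type*} [Field K] [AddCommGroup V] [Module K V] {σ : V →ₗ[K] V →ₗ[K] K}

theorem alternating_apply_add_apply_eq_trace_mul (hσ : σ.IsAlt) (hV : Module.finrank K V = 2)
    (P : V →ₗ[K] V) (X Y : V) :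
    σ (P X) Y + σ X (P Y) = LinearMap.trace K V P * σ X Y := by
  have : FiniteDimensional K V := .of_finrank_pos (by omega)
  let b := Module.finBasisOfFinrankEq K V hV
  suffices h : σ ∘ₗ P + σ.compl₂ P = LinearMap.trace K V P • σ from
    congrArg (fun τ : V →ₗ[K] V →ₗ[K] K => τ X Y) h
  have hP (i : Fin 2) :
      P (b i) = LinearMap.toMatrix b b P 0 i • b 0 + LinearMap.toMatrix b b P 1 i • b 1 := by
    simpa only [LinearMap.toMatrix_apply, Fin.sum_univ_two] using (b.sum_repr (P (b i))).symm
  rw [LinearMap.trace_eq_matrix_trace K b, Matrix.trace_fin_two]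
  refine LinearMap.ext_basis b b fun i j => ?_
  simp only [LinearMap.add_apply, LinearMap.comp_apply, LinearMap.compl₂_apply,
    LinearMap.smul_apply, hP, map_add, map_smul, smul_eq_mul]
  fin_cases i <;> fin_cases j <;>
    simp only [Fin.zero_eta, Fin.mk_one, hσ.self_eq_zero, ← hσ.neg (b 1) (b 0)] <;> ring

theorem apply_apply_eq_trace_smul_sub_of_preserves_alternating (hσ : σ.IsAlt)
    (hσ' : σ.SeparatingLeft) (hV : Module.finrank K V = 2) {P : V →ₗ[K] V}
    (hP : ∀ X Y, σ (P X) (P Y) = σ X Y) (X : V) :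
    P (P X) = LinearMap.trace K V P • P X - X := by
  refine sub_eq_zero.1 (hσ' _ fun Y => ?_)
  have h := alternating_apply_add_apply_eq_trace_mul hσ hV P (P X) Y
  rw [hP] at h
  simp only [map_sub, map_smul, LinearMap.sub_apply, LinearMap.smul_apply, smul_eq_mul]
  linear_combination h

theorem two_smul_apply_eq_trace_smul_of_forall_apply_self_eq_zero (hσ : σ.IsAlt)
    (hσ' : σ.SeparatingLeft) (hV : Module.finrank K V = 2) {P : V →ₗ[K] V}
    (hP : ∀ X, σ X (P X) = 0) (X : V) : (2 : K) • P X = LinearMap.trace K V P • X := by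
  refine sub_eq_zero.1 (hσ' _ fun Y => ?_)
  have hsymm : σ X (P Y) = σ (P X) Y := by
    have h := hP (X + Y)
    rw [map_add, map_add, map_add, LinearMap.add_apply, LinearMap.add_apply, hP, hP] at h
    rw [← hσ.neg Y]
    linear_combination h
  have h := alternating_apply_add_apply_eq_trace_mul hσ hV P X Y
  rw [hsymm] at h
  simp only [map_sub, map_smul, LinearMap.sub_apply, LinearMap.smul_apply, smul_eq_mul]
  linear_combination h

theorem exists_basis_of_alternating_apply_eq_one (hσ : σ.IsAlt) (hV : Module.finrank K V = 2)
    {e f : V} (hef : σ e f = 1) :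
    ∃ b : Module.Basis (Fin 1 ⊕ Fin 1) K V, b (Sum.inl 0) = e ∧ b (Sum.inr 0) = f := by
  have hli : LinearIndependent K (Sum.elim (fun _ : Fin 1 => e) (fun _ : Fin 1 => f)) := by
    rw [Fintype.linearIndependent_iff]
    intro c hc
    simp only [Fintype.sum_sum_type, Finset.univ_unique, Fin.default_eq_zero, Fin.isValue,
      Finset.sum_singleton, Sum.elim_inl, Sum.elim_inr] at hc
    have he := congrArg (σ e) hc
    have hf := congrArg (σ f) hc
    simp only [map_add, map_smul, hσ.self_eq_zero, ← hσ.neg e f, hef, smul_eq_mul, map_zero,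
      mul_zero, zero_add, add_zero, mul_one, mul_neg, neg_eq_zero] at he hf
    rintro (i | i) <;> rwa [Subsingleton.elim i 0]
  refine ⟨basisOfLinearIndependentOfCardEqFinrank hli (by simp [hV]), ?_, ?_⟩ <;> simp

theorem exists_apply_self_eq_intCast_of_ne_zero {E : Type*} [AddCommGroup E] [Module ℝ E]
    {B : E →ₗ[ℝ] E →ₗ[ℝ] ℝ} {e₀ : E} (he₀ : B e₀ e₀ ≠ 0) :
    ∃ e, ∃ τ : ℤ, τ * τ = 1 ∧ B e e = τ := by
  set x := B e₀ e₀
  have hsqrt : (√|x|)⁻¹ * (√|x|)⁻¹ = |x|⁻¹ := by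
    rw [← mul_inv, Real.mul_self_sqrt (abs_nonneg x)]
  have hscale : B ((√|x|)⁻¹ • e₀) ((√|x|)⁻¹ • e₀) = |x|⁻¹ * x := by
    rw [map_smul, map_smul, LinearMap.smul_apply, smul_eq_mul, smul_eq_mul, ← mul_assoc, hsqrt]
  rcases he₀.lt_or_gt with hx | hx
  · refine ⟨_, -1, by norm_num, hscale.trans ?_⟩
    rw [abs_of_neg hx, inv_neg, neg_mul, inv_mul_cancel₀ he₀, Int.cast_neg, Int.cast_one]
  · refine ⟨_, 1, by norm_num, hscale.trans ?_⟩
    rw [abs_of_pos hx, inv_mul_cancel₀ he₀, Int.cast_one]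

end AlternatingPlane

section Conjugacy

variable {σ : ℂ →L[ℝ] ℂ →L[ℝ] ℝ} {P : ℂ →ₗ[ℝ] ℂ}

theorem IsSymplecticallyConjToIntegral.isConjToIntegral
    (h : IsSymplecticallyConjToIntegral σ P) : IsConjToIntegral P :=
  let ⟨b, _, hb⟩ := h
  ⟨b, hb⟩

theorem IsConjToIntegral.exists_trace_eq_intCast (h : IsConjToIntegral P) :
    ∃ k : ℤ, LinearMap.trace ℝ ℂ P = k := by
  obtain ⟨b, N, -, hN⟩ := h
  refine ⟨N.trace, ?_⟩
  rw [LinearMap.trace_eq_matrix_trace ℝ b, hN]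
  exact (AddMonoidHom.map_trace (Int.castAddHom ℝ) N).symm

theorem fromBlocks_smul_one_mem_symplecticGroup {l R : Type*} [DecidableEq l] [Fintype l]
    [CommRing R] {a b c d : R} (h : a * d - b * c = 1) :
    Matrix.fromBlocks (a • 1) (b • 1) (c • 1) (d • 1) ∈ Matrix.symplecticGroup l R := by
  rw [SymplecticGroup.mem_iff, Matrix.J, Matrix.fromBlocks_transpose,
    Matrix.fromBlocks_multiply, Matrix.fromBlocks_multiply]
  simp only [Matrix.mul_zero, Matrix.mul_one, Matrix.mul_neg, Matrix.transpose_smul,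
    Matrix.transpose_one, Matrix.mul_smul, zero_add, add_zero, ← neg_smul,
    ← add_smul, smul_smul]
  congr 1
  · rw [show a * b + b * -a = 0 by ring, zero_smul]
  · rw [show c * b + d * -a = -1 by linear_combination -h, neg_smul, one_smul]
  · rw [show a * d + b * -c = 1 by linear_combination h, one_smul]
  · rw [show c * d + d * -c = 0 by ring, zero_smul]

theorem isSymplecticallyConjToIntegral_of_apply_eq (hσ : σ.toBilinForm.IsAlt) {e f : ℂ}
    (hef : σ e f = 1) {a b c d : ℤ} (hdet : a * d - b * c = 1)
    (he : P e = (a : ℝ) • e + (c : ℝ) • f) (hf : P f = (b : ℝ) • e + (d : ℝ) • f) :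
    IsSymplecticallyConjToIntegral σ P := by
  obtain ⟨B, rfl, rfl⟩ :=
    exists_basis_of_alternating_apply_eq_one hσ Complex.finrank_real_complex hef
  refine ⟨B, hef, _, fromBlocks_smul_one_mem_symplecticGroup hdet, ?_⟩
  rw [← LinearEquiv.eq_symm_apply, LinearMap.toMatrix_symm]
  refine B.ext fun i => ?_
  rw [Matrix.toLin_self, Fintype.sum_sum_type]
  rcases i with i | i <;> fin_cases i <;> simp [he, hf, -zsmul_eq_mul, -zsmul_one]

theorem isSymplecticallyConjToIntegral_of_forall_apply_self_eq_zero (hσ : σ.toBilinForm.IsAlt)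
    (hσ' : σ.toBilinForm.SeparatingLeft) (hP : ∀ X Y, σ (P X) (P Y) = σ X Y)
    (hscalar : ∀ X, σ X (P X) = 0) : IsSymplecticallyConjToIntegral σ P := by
  obtain ⟨a, hPa⟩ : ∃ a : ℝ, ∀ X, P X = a • X := ⟨LinearMap.trace ℝ ℂ P / 2, fun X => by
    have h := two_smul_apply_eq_trace_smul_of_forall_apply_self_eq_zero hσ hσ'
      Complex.finrank_real_complex hscalar X
    rw [div_eq_inv_mul, mul_smul, ← h, inv_smul_smul₀ two_ne_zero]⟩
  obtain ⟨f, hf⟩ : ∃ f, σ 1 f = 1 := by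
    obtain ⟨Y, hY⟩ := not_forall.1 (mt (hσ' 1) one_ne_zero)
    exact ⟨(σ 1 Y)⁻¹ • Y, by rw [map_smul, smul_eq_mul]; exact inv_mul_cancel₀ hY⟩
  have ha : a * a = 1 := by
    have h := hP 1 f
    rwa [hPa, hPa, map_smul, map_smul, smul_apply, hf, smul_eq_mul, smul_eq_mul, mul_one] at h
  obtain ⟨k, rfl, hk⟩ : ∃ k : ℤ, a = k ∧ k * k = 1 := by
    rcases mul_self_eq_one_iff.1 ha with rfl | rfl
    exacts [⟨1, by norm_num, by norm_num⟩, ⟨-1, by norm_num, by norm_num⟩]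
  refine isSymplecticallyConjToIntegral_of_apply_eq hσ hf (a := k) (b := 0) (c := 0) (d := k)
    (by rw [hk, zero_mul, sub_zero]) ?_ ?_ <;> simp [hPa]

/-- The symplectic basis consists of `e` and `± P e`, in which `P` is a companion matrix. -/
theorem isSymplecticallyConjToIntegral_of_apply_self_ne_zero (hσ : σ.toBilinForm.IsAlt)
    (hσ' : σ.toBilinForm.SeparatingLeft) (hP : ∀ X Y, σ (P X) (P Y) = σ X Y) {e₀ : ℂ}
    (he₀ : σ e₀ (P e₀) ≠ 0) {k : ℤ} (hk : LinearMap.trace ℝ ℂ P = k) :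
    IsSymplecticallyConjToIntegral σ P := by
  obtain ⟨e, τ, hττ, he⟩ :=
    exists_apply_self_eq_intCast_of_ne_zero (B := σ.toBilinForm.compl₂ P) he₀
  replace he : σ e (P e) = τ := he
  have hττ' : (τ : ℝ) * τ = 1 := by exact_mod_cast hττ
  refine isSymplecticallyConjToIntegral_of_apply_eq hσ (e := e) (f := (τ : ℝ) • P e)
    (a := 0) (b := -τ) (c := τ) (d := k) ?_ (by linear_combination hττ) ?_ ?_
  · rw [map_smul, he, smul_eq_mul, hττ']
  · rw [Int.cast_zero, zero_smul, zero_add, smul_smul, hττ', one_smul]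
  · rw [map_smul, apply_apply_eq_trace_smul_sub_of_preserves_alternating hσ hσ'
      Complex.finrank_real_complex hP, hk]
    push_cast
    module

theorem isSymplecticallyConjToIntegral_of_trace_eq_intCast (hσ : σ.toBilinForm.IsAlt)
    (hσ' : σ.toBilinForm.SeparatingLeft) (hP : ∀ X Y, σ (P X) (P Y) = σ X Y) {k : ℤ}
    (hk : LinearMap.trace ℝ ℂ P = k) : IsSymplecticallyConjToIntegral σ P := by
  by_cases hscalar : ∀ X, σ X (P X) = 0
  · exact isSymplecticallyConjToIntegral_of_forall_apply_self_eq_zero hσ hσ' hP hscalar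
  · obtain ⟨e₀, he₀⟩ := not_forall.1 hscalar
    exact isSymplecticallyConjToIntegral_of_apply_self_ne_zero hσ hσ' hP he₀ hk

end Conjugacy

section LinearODE

open Asymptotics

variable {E : Type*} [NormedAddCommGroup E] [NormedSpace ℝ E]

/-- `f s t` is differentiable in `s` at `s₀` with derivative `f' t`, uniformly for `t ∈ K`. -/
def HasDerivAtUniformlyOn {α : Type*} (f : ℝ → α → E) (f' : α → E) (K : Set α) (s₀ : ℝ) : Prop :=
  (fun q : ℝ × α => f q.1 q.2 - f s₀ q.2 - (q.1 - s₀) • f' q.2) =o[𝓝 s₀ ×ˢ 𝓟 K]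
    fun q => q.1 - s₀

/-- `P` maps the initial value of each solution on `[0, T]` of the linear equation `Y' = B Y` to
its value at `T`. -/
def IsSolutionMap (B : ℝ → E →L[ℝ] E) (T : ℝ) (P : E → E) : Prop :=
  ∀ v, ∃ Y : ℝ → E, Y 0 = v ∧ Y T = P v ∧
    ∀ t ∈ Icc 0 T, HasDerivWithinAt Y (B t (Y t)) (Icc 0 T) t

theorem hasDerivAtUniformlyOn_of_continuousOn {α : Type*} [TopologicalSpace α]
    {f f' : ℝ → α → E} {J : Set ℝ} {K : Set α} {s₀ : ℝ} (hJ : J ∈ 𝓝 s₀) (hK : IsCompact K)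
    (hf : ∀ s ∈ J, ∀ t ∈ K, HasDerivAt (fun s => f s t) (f' s t) s)
    (hf' : ContinuousOn (fun q : ℝ × α => f' q.1 q.2) (J ×ˢ K)) :
    HasDerivAtUniformlyOn f (f' s₀) K s₀ := by
  refine isLittleO_iff.2 fun ε hε => eventually_prod_principal_iff.2 ?_
  have hclose : ∀ᶠ s in 𝓝[J] s₀, ∀ t ∈ K, ‖f' s t - f' s₀ t‖ < ε := by
    obtain ⟨v, hv, h⟩ :=
      hK.mem_uniformity_of_prod hf' (mem_of_mem_nhds hJ) (Metric.dist_mem_uniformity hε)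
    exact mem_of_superset hv fun s hs t ht => by simpa [dist_eq_norm] using h s hs t ht
  rw [nhdsWithin_eq_nhds.2 hJ] at hclose
  obtain ⟨δ, hδ, hball⟩ := Metric.eventually_nhds_iff_ball.1 (hclose.and hJ)
  filter_upwards [Metric.ball_mem_nhds s₀ hδ] with s hs t ht
  have hmvt := (convex_ball s₀ δ).norm_image_sub_le_of_norm_hasDerivWithin_le
    (f := fun x => f x t - (x - s₀) • f' s₀ t) (f' := fun x => f' x t - f' s₀ t) (C := ε)
    (fun x hx => ((hf x (hball x hx).2 t ht).sub
      (by simpa using ((hasDerivAt_id x).sub_const s₀).smul_const (f' s₀ t)))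
      |>.hasDerivWithinAt)
    (fun x hx => ((hball x hx).1 t ht).le) (Metric.mem_ball_self hδ) hs
  simpa [sub_right_comm] using hmvt

theorem gronwallBound_zero_eq_mul (K ε x : ℝ) :
    gronwallBound 0 K ε x = ε * gronwallBound 0 K 1 x := by
  by_cases hK : K = 0
  · simp [hK, gronwallBound_K0]
  · simp only [gronwallBound_of_K_ne_0 hK, zero_mul, zero_add]
    ring

theorem norm_sub_le_gronwallBound_of_approx_solution {B : ℝ → E →L[ℝ] E} {T ε : ℝ} (hT : 0 ≤ T)
    {L : NNReal} (hB : ∀ t ∈ Icc 0 T, ‖B t‖₊ ≤ L) {Y Z Z' : ℝ → E} (h0 : Y 0 = Z 0)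
    (hY : ∀ t ∈ Icc 0 T, HasDerivWithinAt Y (B t (Y t)) (Icc 0 T) t)
    (hZ : ∀ t ∈ Icc 0 T, HasDerivWithinAt Z (Z' t) (Icc 0 T) t)
    (hZ' : ∀ t ∈ Icc 0 T, ‖Z' t - B t (Z t)‖ ≤ ε) :
    ‖Y T - Z T‖ ≤ gronwallBound 0 L ε T := by
  have hright {W W' : ℝ → E} (hW : ∀ t ∈ Icc 0 T, HasDerivWithinAt W (W' t) (Icc 0 T) t) :
      ∀ t ∈ Ico 0 T, HasDerivWithinAt W (W' t) (Ici t) t := fun t ht =>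
    (hW t (Ico_subset_Icc_self ht)).mono_of_mem_nhdsWithin
      (mem_of_superset (Icc_mem_nhdsGE ht.2) (Icc_subset_Icc_left ht.1))
  have h := dist_le_of_approx_trajectories_ODE_of_mem (v := fun t x => B t x)
    (s := fun _ => univ) (δ := 0) (εf := 0) (εg := ε)
    (fun t ht => ((B t).lipschitz.weaken (hB t (Ico_subset_Icc_self ht))).lipschitzOnWith)
    (fun t ht => (hY t ht).continuousWithinAt) (hright hY) (by simp) (fun _ _ => mem_univ _)
    (fun t ht => (hZ t ht).continuousWithinAt) (hright hZ)
    (fun t ht => by rw [dist_eq_norm]; exact hZ' t (Ico_subset_Icc_self ht))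
    (fun _ _ => mem_univ _) (by simp [h0]) T (right_mem_Icc.2 hT)
  rwa [dist_eq_norm, sub_zero, zero_add] at h

theorem HasDerivAtUniformlyOn.isBigO_sub {α : Type*} {f : ℝ → α → E} {f' : α → E} {K : Set α}
    {s₀ : ℝ} (hf : HasDerivAtUniformlyOn f f' K s₀) {M : ℝ} (hM : ∀ t ∈ K, ‖f' t‖ ≤ M) :
    (fun q : ℝ × α => f q.1 q.2 - f s₀ q.2) =O[𝓝 s₀ ×ˢ 𝓟 K] fun q => q.1 - s₀ := by
  have hlin : (fun q : ℝ × α => (q.1 - s₀) • f' q.2) =O[𝓝 s₀ ×ˢ 𝓟 K] fun q => q.1 - s₀ :=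
    IsBigO.of_bound M <| eventually_prod_principal_iff.2 <| .of_forall fun s t ht => by
      rw [norm_smul, mul_comm]
      exact mul_le_mul_of_nonneg_right (hM t ht) (norm_nonneg _)
  simpa using hf.isBigO.add hlin

theorem isLittleO_fst_sub_one {α : Type*} (s₀ : ℝ) (l : Filter α) :
    (fun q : ℝ × α => q.1 - s₀) =o[𝓝 s₀ ×ˢ l] fun _ => (1 : ℝ) :=
  (isLittleO_one_iff ℝ).2
    (((continuous_sub_right s₀).tendsto' s₀ 0 (sub_self s₀)).comp tendsto_fst)

section Variation

variable {B : ℝ → ℝ → E →L[ℝ] E} {B' : ℝ → E →L[ℝ] E} {Y V : ℝ → E} {T s₀ : ℝ}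

theorem isLittleO_variational_error (hB : HasDerivAtUniformlyOn B B' (Icc 0 T) s₀)
    (hB' : ContinuousOn B' (Icc 0 T)) (hY : ContinuousOn Y (Icc 0 T))
    (hV : ContinuousOn V (Icc 0 T)) :
    (fun q : ℝ × ℝ => B s₀ q.2 (Y q.2) + (q.1 - s₀) • (B s₀ q.2 (V q.2) + B' q.2 (Y q.2))
      - B q.1 q.2 (Y q.2 + (q.1 - s₀) • V q.2)) =o[𝓝 s₀ ×ˢ 𝓟 (Icc 0 T)] fun q => q.1 - s₀ := by
  have hbdd {W : ℝ → E} (hW : ContinuousOn W (Icc 0 T)) :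
      (fun q : ℝ × ℝ => W q.2) =O[𝓝 s₀ ×ˢ 𝓟 (Icc 0 T)] fun _ => (1 : ℝ) := by
    obtain ⟨N, hN⟩ := isCompact_Icc.exists_bound_of_continuousOn hW
    exact .of_bound N <| eventually_prod_principal_iff.2 <| .of_forall fun s t ht => by
      simpa using hN t ht
  have happly {A : ℝ × ℝ → E →L[ℝ] E} {W : ℝ × ℝ → E} :
      (fun q => A q (W q)) =O[𝓝 s₀ ×ˢ 𝓟 (Icc 0 T)] fun q => ‖A q‖ * ‖W q‖ :=
    .of_norm_le fun q => (A q).le_opNorm _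
  obtain ⟨M, hM⟩ := isCompact_Icc.exists_bound_of_continuousOn hB'
  have hfirst := happly.trans_isLittleO (hB.norm_left.mul_isBigO (hbdd hY).norm_left)
  have hsecond := happly.trans_isLittleO ((hB.isBigO_sub hM).norm_left.mul_isLittleO
    ((isLittleO_fst_sub_one s₀ _).smul_isBigO (hbdd hV)).norm_left)
  simp only [smul_eq_mul, mul_one] at hfirst hsecond
  refine (hfirst.add hsecond).neg_left.congr_left fun q => ?_
  simp only [map_add, map_smul, sub_apply, smul_apply]
  module

theorem hasDerivAt_solutionMap_of_variational (hT : 0 ≤ T) (hBs₀ : ContinuousOn (B s₀) (Icc 0 T))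
    (hB : HasDerivAtUniformlyOn B B' (Icc 0 T) s₀) (hB' : ContinuousOn B' (Icc 0 T))
    {P : ℝ → E → E} (hP : ∀ᶠ s in 𝓝 s₀, IsSolutionMap (B s) T (P s))
    (hY : ∀ t ∈ Icc 0 T, HasDerivWithinAt Y (B s₀ t (Y t)) (Icc 0 T) t)
    (hV : ∀ t ∈ Icc 0 T, HasDerivWithinAt V (B s₀ t (V t) + B' t (Y t)) (Icc 0 T) t)
    (hV0 : V 0 = 0) : HasDerivAt (fun s => P s (Y 0)) (V T) s₀ := by
  obtain ⟨K, hK⟩ := isCompact_Icc.exists_bound_of_continuousOn hBs₀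
  obtain ⟨M, hM⟩ := isCompact_Icc.exists_bound_of_continuousOn hB'
  have hbound : ∀ᶠ s in 𝓝 s₀, ∀ t ∈ Icc 0 T, ‖B s t‖₊ ≤ (K + 1).toNNReal := by
    have h := (hB.isBigO_sub hM).trans_isLittleO (isLittleO_fst_sub_one s₀ _)
    filter_upwards [eventually_prod_principal_iff.1 (isLittleO_iff.1 h one_pos)] with s hs t ht
    rw [← norm_toNNReal]
    have htri := norm_le_norm_add_norm_sub' (B s t) (B s₀ t)
    have hst := hs t ht
    rw [norm_one, one_mul] at hst
    exact Real.toNNReal_le_toNNReal (by linarith [hK t ht])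
  have herr := isLittleO_variational_error hB hB' (fun t ht => (hY t ht).continuousWithinAt)
    (fun t ht => (hV t ht).continuousWithinAt)
  have hlin : (fun s => P s (Y 0) - (Y T + (s - s₀) • V T)) =o[𝓝 s₀] fun s => s - s₀ := by
    set G := gronwallBound 0 (K + 1).toNNReal 1 T
    refine isLittleO_iff.2 fun c hc => ?_
    have hc' : 0 < c / (|G| + 1) := by positivity
    filter_upwards [hP, hbound, eventually_prod_principal_iff.1 (isLittleO_iff.1 herr hc')]
      with s hPs hBs hs
    obtain ⟨Z, hZ0, hZT, hZ⟩ := hPs (Y 0)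
    rw [← hZT]
    calc ‖Z T - (Y T + (s - s₀) • V T)‖
        ≤ gronwallBound 0 (K + 1).toNNReal (c / (|G| + 1) * ‖s - s₀‖) T :=
          norm_sub_le_gronwallBound_of_approx_solution hT hBs (by simp [hZ0, hV0]) hZ
            (fun t ht => (hY t ht).add ((hV t ht).const_smul (s - s₀))) hs
      _ = c / (|G| + 1) * ‖s - s₀‖ * G := gronwallBound_zero_eq_mul _ _ _
      _ ≤ c / (|G| + 1) * ‖s - s₀‖ * (|G| + 1) := by
          gcongr
          exact (le_abs_self G).trans (le_add_of_nonneg_right zero_le_one)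
      _ = c * ‖s - s₀‖ := by field_simp
  have hs₀ : P s₀ (Y 0) = Y T := by
    simpa [sub_eq_zero] using (isLittleO_iff.1 hlin one_pos).self_of_nhds
  rw [hasDerivAt_iff_isLittleO, hs₀]
  simpa only [sub_sub] using hlin

end Variation

-- If `Z` solves `Z' = B Z` with `Z 0 = M 0 (Y 0)`, then `M Y - Z` solves the variational equation.
theorem hasDerivAt_solutionMap_of_zero_curvature {B : ℝ → ℝ → E →L[ℝ] E} {B' M : ℝ → E →L[ℝ] E}
    {T s₀ : ℝ} (hT : 0 ≤ T) (hBs₀ : ContinuousOn (B s₀) (Icc 0 T))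
    (hB : HasDerivAtUniformlyOn B B' (Icc 0 T) s₀) (hB' : ContinuousOn B' (Icc 0 T))
    (hM : ∀ t ∈ Icc 0 T,
      HasDerivWithinAt M (B' t + B s₀ t ∘L M t - M t ∘L B s₀ t) (Icc 0 T) t)
    {P : ℝ → E → E} (hP : ∀ᶠ s in 𝓝 s₀, IsSolutionMap (B s) T (P s)) (v : E) :
    HasDerivAt (fun s => P s v) (M T (P s₀ v) - P s₀ (M 0 v)) s₀ := by
  obtain ⟨Y, rfl, hYT, hY⟩ := hP.self_of_nhds v
  obtain ⟨Z, hZ0, hZT, hZ⟩ := hP.self_of_nhds (M 0 (Y 0))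
  rw [← hYT, ← hZT]
  refine hasDerivAt_solutionMap_of_variational (V := fun t => M t (Y t) - Z t) hT hBs₀ hB hB' hP
    hY (fun t ht => ?_) (by simp [hZ0])
  refine (((hM t ht).clm_apply (hY t ht)).sub (hZ t ht)).congr_deriv ?_
  simp only [add_apply, sub_apply, ContinuousLinearMap.comp_apply, map_sub]
  abel

section Trace

variable [FiniteDimensional ℝ E]

theorem hasDerivAt_trace {P : ℝ → E →ₗ[ℝ] E} {P' : E →ₗ[ℝ] E} {s₀ : ℝ}
    (hP : ∀ v, HasDerivAt (fun s => P s v) (P' v) s₀) :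
    HasDerivAt (fun s => LinearMap.trace ℝ E (P s)) (LinearMap.trace ℝ E P') s₀ := by
  let b := Module.finBasis ℝ E
  simp only [LinearMap.trace_eq_matrix_trace ℝ b, Matrix.trace, Matrix.diag_apply,
    LinearMap.toMatrix_apply]
  exact HasDerivAt.fun_sum fun i _ =>
    (LinearMap.toContinuousLinearMap (b.coord i)).hasFDerivAt.comp_hasDerivAt s₀ (hP (b i))

theorem hasDerivAt_trace_solutionMap_of_zero_curvature {B : ℝ → ℝ → E →L[ℝ] E}
    {B' M : ℝ → E →L[ℝ] E} {T s₀ : ℝ} (hT : 0 ≤ T) (hBs₀ : ContinuousOn (B s₀) (Icc 0 T))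
    (hB : HasDerivAtUniformlyOn B B' (Icc 0 T) s₀) (hB' : ContinuousOn B' (Icc 0 T))
    (hM : ∀ t ∈ Icc 0 T,
      HasDerivWithinAt M (B' t + B s₀ t ∘L M t - M t ∘L B s₀ t) (Icc 0 T) t) (hMT : M T = M 0)
    {P : ℝ → E →ₗ[ℝ] E} (hP : ∀ᶠ s in 𝓝 s₀, IsSolutionMap (B s) T (P s)) :
    HasDerivAt (fun s => LinearMap.trace ℝ E (P s)) 0 s₀ := by
  have hLax : LinearMap.trace ℝ E ((M 0 : E →ₗ[ℝ] E) * P s₀ - P s₀ * (M 0 : E →ₗ[ℝ] E)) = 0 := by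
    rw [map_sub, LinearMap.trace_mul_comm, sub_self]
  rw [← hLax]
  refine hasDerivAt_trace fun v => ?_
  simpa [hMT] using hasDerivAt_solutionMap_of_zero_curvature hT hBs₀ hB hB' hM hP v

end Trace

end LinearODE

section LocalStructure

open scoped ComplexConjugate

theorem bilinear_apply_eq_sum_re_im {F : Type*} [AddCommGroup F] [Module ℝ F] [TopologicalSpace F]
    [IsTopologicalAddGroup F] [ContinuousConstSMul ℝ F] (f : ℂ →L[ℝ] ℂ →L[ℝ] F) (X Y : ℂ) :
    f X Y = (X.re * Y.re) • f 1 1 + (X.re * Y.im) • f 1 Complex.I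
      + (X.im * Y.re) • f Complex.I 1 + (X.im * Y.im) • f Complex.I Complex.I := by
  have hdecomp (Z : ℂ) : Z = Z.re • (1 : ℂ) + Z.im • Complex.I := by simp
  conv_lhs => rw [hdecomp X, hdecomp Y]
  simp only [map_add, map_smul, add_apply, smul_apply]
  module

namespace LocalSpecialKahler

variable {U : Set ℂ} (S : LocalSpecialKahler U)

/-- The coefficient `a` in `Γ(X) Y = a X Y + c X̄ Ȳ`. -/
noncomputable def linearCoeff (p : ℂ) : ℂ := (S.Γ p 1 1 - Complex.I * S.Γ p 1 Complex.I) / 2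

/-- The coefficient `c` in `Γ(X) Y = a X Y + c X̄ Ȳ`. -/
noncomputable def conjCoeff (p : ℂ) : ℂ := (S.Γ p 1 1 + Complex.I * S.Γ p 1 Complex.I) / 2

theorem continuousOn_linearCoeff : ContinuousOn S.linearCoeff U := by
  have hΓ (X Y : ℂ) : ContinuousOn (fun p => S.Γ p X Y) U :=
    (S.Γ_smooth.continuousOn.clm_apply continuousOn_const).clm_apply continuousOn_const
  exact ((hΓ 1 1).sub (continuousOn_const.mul (hΓ 1 Complex.I))).div_const 2

variable {p : ℂ}

theorem connection_apply (hp : p ∈ U) (X Y : ℂ) :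
    S.Γ p X Y = S.linearCoeff p * X * Y + S.conjCoeff p * conj X * conj Y := by
  have hI1 := S.torsion_free p hp Complex.I 1
  have hII : S.Γ p Complex.I Complex.I = -S.Γ p 1 1 := by
    have hspecial := S.special p hp 1 Complex.I
    simp only [covDerivI, Complex.I_mul_I, mul_one, map_neg, hI1] at hspecial
    linear_combination -hspecial
  rw [bilinear_apply_eq_sum_re_im, hI1, hII, linearCoeff, conjCoeff]
  generalize S.Γ p 1 1 = u
  generalize S.Γ p 1 Complex.I = v
  apply Complex.ext <;> simp <;> ring

theorem metric_apply (hp : p ∈ U) (X Y : ℂ) :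
    S.g p X Y = S.conformalFactor p * (X.re * Y.re + X.im * Y.im) := by
  have hII := S.g_hermitian p hp 1 1
  have h1I : S.g p 1 Complex.I = 0 := by
    have hsymm := S.g_symm p hp Complex.I 1
    have hherm := S.g_hermitian p hp 1 Complex.I
    simp only [Complex.I_mul_I, mul_one, map_neg] at hherm
    linarith
  rw [mul_one] at hII
  rw [bilinear_apply_eq_sum_re_im, S.g_symm p hp Complex.I 1, h1I, hII, conformalFactor]
  simp only [smul_eq_mul]
  ring

theorem kahlerForm_apply (hp : p ∈ U) (X Y : ℂ) :
    S.kahlerForm p X Y = S.conformalFactor p * (X.re * Y.im - X.im * Y.re) := by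
  have hdef : S.kahlerForm p X Y = S.g p (Complex.I * X) Y := rfl
  rw [hdef, S.metric_apply hp, Complex.I_mul_re, Complex.I_mul_im]
  ring

theorem conformalFactor_pos (hp : p ∈ U) : 0 < S.conformalFactor p :=
  S.g_pos p hp 1 one_ne_zero

theorem isAlt_kahlerForm (hp : p ∈ U) : (S.kahlerForm p).toBilinForm.IsAlt := fun X =>
  (S.kahlerForm_apply hp X X).trans (by ring)

theorem separatingLeft_kahlerForm (hp : p ∈ U) :
    (S.kahlerForm p).toBilinForm.SeparatingLeft := fun X hX => by
  by_contra hX0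
  have hIX : S.kahlerForm p X (Complex.I * X) = S.g p X X := by
    rw [S.kahlerForm_apply hp, S.metric_apply hp, Complex.I_mul_re, Complex.I_mul_im]
    ring
  exact (S.g_pos p hp X hX0).ne' (hIX.symm.trans (hX (Complex.I * X)))

theorem norm_conjCoeff_mul_conformalFactor (hp : p ∈ U) :
    ‖S.conjCoeff p‖ * S.conformalFactor p = 2 * ‖S.cubicCoeff p‖ := by
  have hcubic : S.cubicCoeff p =
      -(Complex.I * S.conformalFactor p / 2) * conj (S.conjCoeff p) := by
    simp only [cubicCoeff, cubicForm, kahlerFormC, projOneZero, covDerivProj, covDerivI,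
      S.kahlerForm_apply hp, S.connection_apply hp]
    apply Complex.ext <;> simp <;> ring
  rw [hcubic, norm_mul, norm_neg, norm_div, norm_mul, Complex.norm_I, Complex.norm_real,
    RCLike.norm_conj, Real.norm_of_nonneg (S.conformalFactor_pos hp).le, Complex.norm_two]
  ring

theorem differentiableAt_kahlerForm (hU : IsOpen U) (hp : p ∈ U) :
    DifferentiableAt ℝ S.kahlerForm p :=
  ((S.g_smooth.contDiffAt (hU.mem_nhds hp)).differentiableAt (by simp)).clm_comp
    (differentiableAt_const _)

theorem differentiableAt_connection (hU : IsOpen U) (hp : p ∈ U) : DifferentiableAt ℝ S.Γ p :=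
  (S.Γ_smooth.contDiffAt (hU.mem_nhds hp)).differentiableAt (by simp)

theorem hasFDerivAt_conformalFactor (hU : IsOpen U) (hp : p ∈ U) :
    HasFDerivAt S.conformalFactor ((2 * S.conformalFactor p) •
      Complex.reCLM ∘L ContinuousLinearMap.mul ℝ ℂ (S.linearCoeff p)) p := by
  have hkahler := (((S.differentiableAt_kahlerForm hU hp).hasFDerivAt.clm_apply
    (hasFDerivAt_const (1 : ℂ) p)).clm_apply (hasFDerivAt_const Complex.I p))
  have heq : S.conformalFactor =ᶠ[𝓝 p] fun q => S.kahlerForm q 1 Complex.I := by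
    filter_upwards [hU.mem_nhds hp] with q hq
    simp [S.kahlerForm_apply hq]
  refine (hkahler.congr_of_eventuallyEq heq).congr_fderiv (ContinuousLinearMap.ext fun X => ?_)
  have hparallel : fderiv ℝ S.kahlerForm p X 1 Complex.I =
      S.kahlerForm p (S.Γ p X 1) Complex.I + S.kahlerForm p 1 (S.Γ p X Complex.I) :=
    S.symplectic p hp X 1 Complex.I
  rw [S.kahlerForm_apply hp, S.kahlerForm_apply hp, S.connection_apply hp,
    S.connection_apply hp] at hparallel
  simp [hparallel]
  ring

theorem hasFDerivAt_log_conformalFactor (hU : IsOpen U) (hp : p ∈ U) :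
    HasFDerivAt (fun p => Real.log (S.conformalFactor p))
      ((2 : ℝ) • Complex.reCLM ∘L ContinuousLinearMap.mul ℝ ℂ (S.linearCoeff p)) p := by
  have hw := (S.conformalFactor_pos hp).ne'
  refine ((S.hasFDerivAt_conformalFactor hU hp).log hw).congr_fderiv ?_
  rw [smul_smul]
  congr 1
  field_simp

end LocalSpecialKahler

end LocalStructure

section CircleHolonomy

open scoped Real

theorem circleMap_zero_mem_ball_diff {R s : ℝ} (hs : s ∈ Ioo 0 R) (t : ℝ) :
    circleMap 0 s t ∈ Metric.ball (0 : ℂ) R \ {0} := by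
  simp [circleMap_eq_center_iff, abs_of_pos hs.1, hs.1.ne', hs.2]

theorem hasDerivAt_circleMap_radius (c : ℂ) (s t : ℝ) :
    HasDerivAt (fun s => circleMap c s t) (circleMap 0 1 t) s := by
  simpa [circleMap] using
    ((Complex.ofRealCLM.hasDerivAt (x := s)).mul_const (Complex.exp (t * Complex.I))).const_add c

namespace LocalSpecialKahler

variable {U : Set ℂ} (S : LocalSpecialKahler U) {s t : ℝ}

/-- The derivative of `circleCoeff` in the radius. -/
noncomputable def circleCoeffDeriv (s t : ℝ) : ℂ →L[ℝ] ℂ :=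
  -(fderiv ℝ S.Γ (circleMap 0 s t) (circleMap 0 1 t) (circleMap 0 s t * Complex.I)
    + S.Γ (circleMap 0 s t) (circleMap 0 1 t * Complex.I))

/-- The coefficient of the equation of parallel vector fields along the ray `s ↦ s e^{it}`. -/
noncomputable def radialCoeff (s t : ℝ) : ℂ →L[ℝ] ℂ := -S.Γ (circleMap 0 s t) (circleMap 0 1 t)

theorem circleCoeff_eq (s t : ℝ) :
    S.circleCoeff s t = -S.Γ (circleMap 0 s t) (circleMap 0 s t * Complex.I) := by
  simp [circleCoeff]

theorem hasDerivAt_circleCoeff_radius (hU : IsOpen U) (hp : circleMap 0 s t ∈ U) :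
    HasDerivAt (fun s => S.circleCoeff s t) (S.circleCoeffDeriv s t) s := by
  have hray := hasDerivAt_circleMap_radius 0 s t
  have hΓ := HasFDerivAt.comp_hasDerivAt (l := S.Γ) s
    (S.differentiableAt_connection hU hp).hasFDerivAt hray
  simp only [circleCoeff_eq]
  exact (hΓ.clm_apply (hray.mul_const Complex.I)).neg

theorem continuousOn_circleCoeffDeriv (hU : IsOpen U) {J : Set ℝ}
    (hJ : ∀ s ∈ J, ∀ t, circleMap 0 s t ∈ U) :
    ContinuousOn (fun q : ℝ × ℝ => S.circleCoeffDeriv q.1 q.2) (J ×ˢ univ) := by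
  have hmem : MapsTo (fun q : ℝ × ℝ => circleMap 0 q.1 q.2) (J ×ˢ univ) U :=
    fun q hq => hJ q.1 hq.1 q.2
  have hcircle : Continuous (fun q : ℝ × ℝ => circleMap 0 q.1 q.2) := by
    unfold circleMap; fun_prop
  have hunit : Continuous (fun q : ℝ × ℝ => circleMap 0 1 q.2) :=
    (continuous_circleMap 0 1).comp continuous_snd
  have hΓ := S.Γ_smooth.continuousOn.comp hcircle.continuousOn hmem
  have hΓ' := (S.Γ_smooth.continuousOn_fderiv_of_isOpen hU (by simp)).comp
    hcircle.continuousOn hmem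
  exact (((hΓ'.clm_apply hunit.continuousOn).clm_apply
    (hcircle.mul continuous_const).continuousOn).add
    (hΓ.clm_apply (hunit.mul continuous_const).continuousOn)).neg

theorem hasDerivAt_radialCoeff_angle (hU : IsOpen U) (hp : circleMap 0 s t ∈ U) :
    HasDerivAt (S.radialCoeff s)
      (S.circleCoeffDeriv s t + S.circleCoeff s t ∘L S.radialCoeff s t
        - S.radialCoeff s t ∘L S.circleCoeff s t) t := by
  have hΓ := HasFDerivAt.comp_hasDerivAt (l := S.Γ) t
    (S.differentiableAt_connection hU hp).hasFDerivAt (hasDerivAt_circleMap 0 s t)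
  refine (hΓ.clm_apply (hasDerivAt_circleMap 0 1 t)).neg.congr_deriv
    (ContinuousLinearMap.ext fun Z => ?_)
  have hflat := S.flat _ hp (circleMap 0 1 t) (circleMap 0 s t * Complex.I) Z
  simp only [radialCoeff, circleCoeff_eq, circleCoeffDeriv, neg_apply, add_apply, sub_apply,
    ContinuousLinearMap.comp_apply, map_neg, neg_neg, Function.comp_apply]
  linear_combination hflat

theorem isSolutionMap_holonomy (h : ∀ t, circleMap 0 s t ∈ U) :
    IsSolutionMap (S.circleCoeff s) (2 * π) (S.holonomy s h) := fun v =>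
  have ⟨Y, hY0, hY⟩ := SolvesLinear.exists Real.two_pi_pos.le (S.continuousOn_circleCoeff h) v
  ⟨Y, hY0, hY0 ▸ (solutionMap_apply _ (S.continuousOn_circleCoeff h) hY).symm, hY⟩

theorem trace_holonomy_eq (hU : IsOpen U) {R s₁ s₂ : ℝ} (hRU : Metric.ball 0 R \ {0} ⊆ U)
    (hs₁ : s₁ ∈ Ioo 0 R) (hs₂ : s₂ ∈ Ioo 0 R) (h₁ : ∀ t, circleMap 0 s₁ t ∈ U)
    (h₂ : ∀ t, circleMap 0 s₂ t ∈ U) :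
    LinearMap.trace ℝ ℂ (S.holonomy s₁ h₁) = LinearMap.trace ℝ ℂ (S.holonomy s₂ h₂) := by
  classical
  have hmem (s) (hs : s ∈ Ioo 0 R) (t) : circleMap 0 s t ∈ U :=
    hRU (circleMap_zero_mem_ball_diff hs t)
  have hcont := S.continuousOn_circleCoeffDeriv hU hmem
  let P (s : ℝ) : ℂ →ₗ[ℝ] ℂ :=
    if h : ∀ t, circleMap 0 s t ∈ U then S.holonomy s h else 0
  have hP (s) (h : ∀ t, circleMap 0 s t ∈ U) : P s = S.holonomy s h := dif_pos h
  have hderiv (s) (hs : s ∈ Ioo 0 R) : HasDerivAt (fun s => LinearMap.trace ℝ ℂ (P s)) 0 s := by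
    have hnhds : Ioo 0 R ∈ 𝓝 s := Ioo_mem_nhds hs.1 hs.2
    refine hasDerivAt_trace_solutionMap_of_zero_curvature (B := S.circleCoeff)
      (B' := S.circleCoeffDeriv s) (M := S.radialCoeff s) Real.two_pi_pos.le
      (S.continuousOn_circleCoeff (hmem s hs)) ?_
      (hcont.comp (f := fun t => (s, t)) (by fun_prop) fun t _ => ⟨hs, mem_univ t⟩)
      (fun t _ => (S.hasDerivAt_radialCoeff_angle hU (hmem s hs t)).hasDerivWithinAt)
      (by simp [radialCoeff, circleMap]) ?_
    · exact hasDerivAtUniformlyOn_of_continuousOn hnhds isCompact_Icc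
        (fun x hx t _ => S.hasDerivAt_circleCoeff_radius hU (hmem x hx t))
        (hcont.mono (prod_mono subset_rfl (subset_univ _)))
    · filter_upwards [hnhds] with x hx
      rw [hP x (hmem x hx)]
      exact S.isSolutionMap_holonomy (hmem x hx)
  rw [← hP s₁ h₁, ← hP s₂ h₂]
  exact isOpen_Ioo.is_const_of_deriv_eq_zero isPreconnected_Ioo
    (fun s hs => (hderiv s hs).differentiableAt.differentiableWithinAt)
    (fun s hs => (hderiv s hs).deriv) hs₁ hs₂

theorem kahlerForm_holonomy (hU : IsOpen U) (h : ∀ t, circleMap 0 s t ∈ U) (X Y : ℂ) :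
    S.kahlerForm s (S.holonomy s h X) (S.holonomy s h Y) = S.kahlerForm s X Y := by
  obtain ⟨V, rfl, hVT, hV⟩ := S.isSolutionMap_holonomy h X
  obtain ⟨W, rfl, hWT, hW⟩ := S.isSolutionMap_holonomy h Y
  have hderiv (t) (ht : t ∈ Icc 0 (2 * π)) : HasDerivWithinAt
      (fun t => S.kahlerForm (circleMap 0 s t) (V t) (W t)) 0 (Icc 0 (2 * π)) t := by
    have hω := (HasFDerivAt.comp_hasDerivAt (l := S.kahlerForm) t
      (S.differentiableAt_kahlerForm hU (h t)).hasFDerivAt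
      (hasDerivAt_circleMap 0 s t)).hasDerivWithinAt (s := Icc 0 (2 * π))
    refine ((hω.clm_apply (hV t ht)).clm_apply (hW t ht)).congr_deriv ?_
    have hparallel : fderiv ℝ S.kahlerForm (circleMap 0 s t) (circleMap 0 s t * Complex.I) (V t)
        (W t) = _ := S.symplectic _ (h t) _ _ _
    rw [add_apply, hparallel, circleCoeff_eq]
    simp only [neg_apply, map_neg, kahlerForm, Function.comp_apply]
    ring
  have hconst := constant_of_derivWithin_zero
    (fun t ht => (hderiv t ht).differentiableWithinAt)
    (fun t ht => (hderiv t (Ico_subset_Icc_self ht)).derivWithin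
      (uniqueDiffOn_Icc Real.two_pi_pos t (Ico_subset_Icc_self ht)))
    (2 * π) (right_mem_Icc.2 Real.two_pi_pos.le)
  simpa [circleMap, hVT, hWT] using hconst

end LocalSpecialKahler

end CircleHolonomy

section CircleAverage

open scoped Real

variable {E : Type*} [NormedAddCommGroup E] [NormedSpace ℝ E]

theorem eventually_forall_circleMap {P : ℂ → Prop} {c : ℂ} (h : ∀ᶠ p in 𝓝[≠] c, P p) :
    ∀ᶠ s in 𝓝[>] (0 : ℝ), ∀ t, P (circleMap c s t) := by
  obtain ⟨δ, hδ, hball⟩ := Metric.eventually_nhds_iff_ball.1 (eventually_nhdsWithin_iff.1 h)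
  filter_upwards [Ioo_mem_nhdsGT hδ] with s hs t
  exact hball _ (by simpa [dist_eq_norm, circleMap, abs_of_pos hs.1] using hs.2)
    (circleMap_ne_center hs.1.ne')

theorem tendsto_circleAverage [CompleteSpace E] {f : ℂ → E} {c : ℂ} {b : E}
    (hf : Tendsto f (𝓝[≠] c) (𝓝 b)) (hint : ∀ᶠ s in 𝓝[>] (0 : ℝ), CircleIntegrable f c s) :
    Tendsto (Real.circleAverage f c) (𝓝[>] 0) (𝓝 b) := by
  refine Metric.tendsto_nhds.2 fun ε hε => ?_
  filter_upwards [hint,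
    eventually_forall_circleMap (Metric.tendsto_nhds.1 hf (ε / 2) (half_pos hε))] with s hints hs
  have hclose (t : ℝ) : ‖f (circleMap c s t) - b‖ ≤ ε / 2 := by
    rw [← dist_eq_norm]
    exact (hs t).le
  rw [dist_eq_norm, ← Real.circleAverage_const b c s, ← Real.circleAverage_sub hints
    (circleIntegrable_const b c s), Real.circleAverage_def, norm_smul, norm_inv,
    Real.norm_of_nonneg Real.two_pi_pos.le, inv_mul_lt_iff₀ Real.two_pi_pos]
  have hle := intervalIntegral.norm_integral_le_of_norm_le_const (a := 0) (b := 2 * π)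
    fun t _ => hclose t
  rw [sub_zero, abs_of_pos Real.two_pi_pos] at hle
  calc _ ≤ ε / 2 * (2 * π) := hle
    _ < 2 * π * ε := by nlinarith [Real.pi_pos]

theorem hasDerivAt_circleAverage {U : Set ℂ} (hU : IsOpen U) {f : ℂ → E} {f' : ℂ → ℂ →L[ℝ] E}
    (hf : ∀ p ∈ U, HasFDerivAt f (f' p) p) (hf' : ContinuousOn f' U) {c : ℂ} {s : ℝ}
    (hs : ∀ t, circleMap c s t ∈ U) :
    HasDerivAt (Real.circleAverage f c)
      ((2 * π)⁻¹ • ∫ t in 0..2 * π, f' (circleMap c s t) (circleMap 0 1 t)) s := by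
  let F' (x t : ℝ) : E := f' (circleMap c x t) (circleMap 0 1 t)
  have hcircle : Continuous (fun q : ℝ × ℝ => circleMap c q.1 q.2) := by
    unfold circleMap; fun_prop
  have hunit : Continuous (fun q : ℝ × ℝ => circleMap 0 1 q.2) :=
    (continuous_circleMap 0 1).comp continuous_snd
  have hF' (t : ℝ) : ContinuousAt (fun q : ℝ × ℝ => F' q.1 q.2) (s, t) :=
    ((hf'.continuousAt (hU.mem_nhds (hs t))).comp (f := fun q : ℝ × ℝ => circleMap c q.1 q.2)
      hcircle.continuousAt).clm_apply hunit.continuousAt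
  have hF's : Continuous (F' s) := continuous_iff_continuousAt.2 fun t =>
    (hF' t).comp (f := fun t => (s, t)) (by fun_prop)
  obtain ⟨K, hK⟩ := (isCompact_Icc (a := 0) (b := 2 * π)).exists_bound_of_continuousOn
    hF's.continuousOn
  have hnear : ∀ᶠ x in 𝓝 s, ∀ t ∈ Icc 0 (2 * π), circleMap c x t ∈ U ∧ ‖F' x t‖ < K + 1 :=
    isCompact_Icc.eventually_forall_of_forall_eventually fun t ht =>
      (hcircle.continuousAt.eventually (hU.mem_nhds (hs t))).and
        ((hF' t).norm.eventually_lt_const ((hK t ht).trans_lt (lt_add_one K)))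
  have hmeas (x : ℝ) (hx : ∀ t ∈ Icc 0 (2 * π), circleMap c x t ∈ U) :
      ContinuousOn (fun t => f (circleMap c x t)) (Icc 0 (2 * π)) := fun t ht =>
    ((hf _ (hx t ht)).continuousAt.comp (f := circleMap c x)
      (continuous_circleMap c x).continuousAt).continuousWithinAt
  have hIoc : uIoc 0 (2 * π) ⊆ Icc 0 (2 * π) := by
    rw [uIoc_of_le Real.two_pi_pos.le]
    exact Ioc_subset_Icc_self
  refine (intervalIntegral.hasDerivAt_integral_of_dominated_loc_of_deriv_le
    (F := fun x t => f (circleMap c x t)) (F' := F') (bound := fun _ => K + 1) hnear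
    (hnear.mono fun x hx => ((hmeas x fun t ht => (hx t ht).1).mono hIoc).aestronglyMeasurable
      measurableSet_uIoc)
    ((hmeas s fun t _ => hs t).intervalIntegrable_of_Icc Real.two_pi_pos.le)
    hF's.aestronglyMeasurable
    (.of_forall fun t ht x hx => (hx t (hIoc ht)).2.le) intervalIntegrable_const
    (.of_forall fun t ht x hx => ?_)).2.const_smul (2 * π)⁻¹
  exact (hf _ (hx t (hIoc ht)).1).comp_hasDerivAt x (hasDerivAt_circleMap_radius c x t)

end CircleAverage

-- The mean value theorem for `ψ` and `log` on `[s², s]`, where `log s² = 2 log s`.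
theorem mapClusterPt_mul_deriv_of_tendsto_div_log {ψ ψ' : ℝ → ℝ} {b : ℝ}
    (hψ : ∀ᶠ s in 𝓝[>] 0, HasDerivAt ψ (ψ' s) s)
    (hlim : Tendsto (fun s => ψ s / Real.log s) (𝓝[>] 0) (𝓝 b)) :
    MapClusterPt b (𝓝[>] 0) fun s => s * ψ' s := by
  have hsq : Tendsto (fun s : ℝ => s ^ 2) (𝓝[>] 0) (𝓝[>] 0) :=
    tendsto_nhdsWithin_iff.2 ⟨((continuous_pow 2).tendsto' 0 0 (by simp)).mono_left
      nhdsWithin_le_nhds, eventually_mem_nhdsWithin.mono fun s hs => pow_pos (mem_Ioi.1 hs) 2⟩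
  have hslope : Tendsto (fun s => 2 * (ψ (s ^ 2) / Real.log (s ^ 2)) - ψ s / Real.log s)
      (𝓝[>] 0) (𝓝 b) := by
    simpa [two_mul] using ((hlim.comp hsq).const_mul 2).sub hlim
  obtain ⟨δ, hδ, hderiv⟩ := mem_nhdsGT_iff_exists_Ioo_subset.1 hψ
  have hmvt : ∀ᶠ s in 𝓝[>] (0 : ℝ), ∃ ξ ∈ Ioo (s ^ 2) s,
      2 * (ψ (s ^ 2) / Real.log (s ^ 2)) - ψ s / Real.log s = ξ * ψ' ξ := by
    filter_upwards [Ioo_mem_nhdsGT (lt_min hδ one_pos)] with s hs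
    have hs1 := hs.2.trans_le (min_le_right _ _)
    have hlog := (Real.log_neg hs.1 hs1).ne
    have hpos (x) (hx : x ∈ Icc (s ^ 2) s) : 0 < x := (pow_pos hs.1 2).trans_le hx.1
    have hψ' (x) (hx : x ∈ Icc (s ^ 2) s) : HasDerivAt ψ (ψ' x) x :=
      hderiv ⟨hpos x hx, hx.2.trans_lt (hs.2.trans_le (min_le_left _ _))⟩
    have hlog' (x) (hx : x ∈ Icc (s ^ 2) s) : HasDerivAt Real.log x⁻¹ x :=
      Real.hasDerivAt_log (hpos x hx).ne'
    obtain ⟨ξ, hξ, hratio⟩ := exists_ratio_hasDerivAt_eq_ratio_slope ψ ψ'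
      (pow_lt_self_of_lt_one₀ hs.1 hs1 one_lt_two)
      (fun x hx => (hψ' x hx).continuousAt.continuousWithinAt)
      (fun x hx => hψ' x (Ioo_subset_Icc_self hx)) Real.log (·⁻¹)
      (fun x hx => (hlog' x hx).continuousAt.continuousWithinAt)
      (fun x hx => hlog' x (Ioo_subset_Icc_self hx))
    refine ⟨ξ, hξ, ?_⟩
    have hξ0 := (hpos ξ (Ioo_subset_Icc_self hξ)).ne'
    rw [Real.log_pow] at hratio ⊢
    push_cast at hratio ⊢
    field_simp at hratio ⊢
    linear_combination hratio
  obtain ⟨ξ, hξ⟩ := hmvt.choice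
  have hξlim : Tendsto ξ (𝓝[>] 0) (𝓝[>] 0) := tendsto_nhdsWithin_iff.2
    ⟨tendsto_of_tendsto_of_tendsto_of_le_of_le' (hsq.mono_right nhdsWithin_le_nhds)
      nhdsWithin_le_nhds (hξ.mono fun s hs => hs.1.1.le) (hξ.mono fun s hs => hs.1.2.le),
      hξ.mono fun s hs => (sq_nonneg s).trans_lt hs.1.1⟩
  exact .of_comp hξlim (hslope.congr' (hξ.mono fun s hs => hs.2)).mapClusterPt

section AntilinearPerturbation

open scoped ComplexConjugate

theorem gronwallBound_zero_self_mul (k δ x : ℝ) :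
    gronwallBound 0 k (k * δ) x = δ * (Real.exp (k * x) - 1) := by
  by_cases hk : k = 0
  · simp [hk, gronwallBound_K0]
  · rw [gronwallBound_of_K_ne_0 hk]
    field_simp
    ring

-- The integrating factor removes `α`, so that Gronwall's inequality only sees `κ`.
theorem norm_exp_integral_mul_sub_le {α κ Y : ℝ → ℂ} {T k : ℝ} (hT : 0 ≤ T) (hα : Continuous α)
    (hκ : ∀ t ∈ Icc 0 T, ‖κ t‖ ≤ k)
    (hY : ∀ t ∈ Icc 0 T, HasDerivWithinAt Y (-(α t * Y t + κ t * conj (Y t))) (Icc 0 T) t) :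
    ‖Complex.exp (∫ s in 0..T, α s) * Y T - Y 0‖ ≤ ‖Y 0‖ * (Real.exp (k * T) - 1) := by
  let m (t : ℝ) : ℂ := Complex.exp (∫ s in 0..t, α s)
  have hm (t : ℝ) : HasDerivAt m (m t * α t) t :=
    (hα.integral_hasStrictDerivAt 0 t).hasDerivAt.cexp
  have hmY (t) (ht : t ∈ Icc 0 T) : HasDerivWithinAt (fun t => m t * Y t - Y 0)
      (-(m t * κ t * conj (Y t))) (Icc 0 T) t := by
    refine (((hm t).hasDerivWithinAt.mul (hY t ht)).sub_const (Y 0)).congr_deriv ?_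
    ring
  have hbound := norm_le_gronwallBound_of_norm_deriv_right_le
    (f := fun t => m t * Y t - Y 0) (δ := 0) (K := k) (ε := k * ‖Y 0‖) (a := 0) (b := T)
    (fun t ht => (hmY t ht).continuousWithinAt)
    (fun t ht => (hmY t (Ico_subset_Icc_self ht)).mono_of_mem_nhdsWithin
      (mem_of_superset (Icc_mem_nhdsGE ht.2) (Icc_subset_Icc_left ht.1)))
    (by simp [m])
    (fun t ht => by
      have hκt := hκ t (Ico_subset_Icc_self ht)
      calc ‖-(m t * κ t * conj (Y t))‖ = ‖κ t‖ * ‖m t * Y t‖ := by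
            rw [norm_neg, norm_mul, norm_mul, norm_mul, RCLike.norm_conj]; ring
        _ ≤ k * (‖m t * Y t - Y 0‖ + ‖Y 0‖) :=
            mul_le_mul hκt (norm_le_norm_sub_add _ _) (norm_nonneg _) ((norm_nonneg _).trans hκt)
        _ = k * ‖m t * Y t - Y 0‖ + k * ‖Y 0‖ := mul_add _ _ _) T (right_mem_Icc.2 hT)
  rwa [sub_zero, gronwallBound_zero_self_mul] at hbound

theorem abs_trace_sub_two_mul_re_le {P : ℂ →ₗ[ℝ] ℂ} {u : ℂ} {ε : ℝ}
    (hP : ∀ v, ‖P v - u * v‖ ≤ ε * ‖v‖) : |LinearMap.trace ℝ ℂ P - 2 * u.re| ≤ 2 * ε := by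
  have htrace : LinearMap.trace ℝ ℂ P = (P 1).re + (P Complex.I).im := by
    rw [LinearMap.trace_eq_matrix_trace ℝ Complex.basisOneI, Matrix.trace_fin_two]
    simp [LinearMap.toMatrix_apply]
  have hre := (Complex.abs_re_le_norm _).trans (hP 1)
  have him := (Complex.abs_im_le_norm _).trans (hP Complex.I)
  rw [mul_one, norm_one, mul_one, Complex.sub_re] at hre
  rw [Complex.norm_I, mul_one, Complex.sub_im, Complex.mul_I_im] at him
  calc |LinearMap.trace ℝ ℂ P - 2 * u.re|
      = |((P 1).re - u.re) + ((P Complex.I).im - u.re)| := by rw [htrace]; ring_nf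
    _ ≤ ε + ε := (abs_add_le _ _).trans (add_le_add hre him)
    _ = 2 * ε := (two_mul ε).symm

end AntilinearPerturbation

section HolonomyTrace

open scoped Real ComplexConjugate

namespace LocalSpecialKahler

variable {U : Set ℂ} (S : LocalSpecialKahler U) {s : ℝ}

/-- The real number `θ` with `∮ a dz = iθ` over the circle of radius `s`, for the complex linear
part `a dz` of the connection. -/
noncomputable def rotationAngle (s : ℝ) : ℝ :=
  ∫ t in 0..2 * π, (S.linearCoeff (circleMap 0 s t) * circleMap 0 s t).re

theorem continuous_linearCoeff_circleMap (h : ∀ t, circleMap 0 s t ∈ U) :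
    Continuous fun t => S.linearCoeff (circleMap 0 s t) :=
  S.continuousOn_linearCoeff.comp_continuous (continuous_circleMap 0 s) h

theorem integral_linearCoeff_mul_deriv_circleMap (hU : IsOpen U) (h : ∀ t, circleMap 0 s t ∈ U) :
    ∫ t in 0..2 * π, S.linearCoeff (circleMap 0 s t) * (circleMap 0 s t * Complex.I) =
      S.rotationAngle s * Complex.I := by
  have hcont : Continuous fun t =>
      S.linearCoeff (circleMap 0 s t) * (circleMap 0 s t * Complex.I) :=
    (S.continuous_linearCoeff_circleMap h).mul ((continuous_circleMap 0 s).mul_const Complex.I)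
  have hderiv (t : ℝ) : HasDerivAt (fun t => Real.log (S.conformalFactor (circleMap 0 s t)))
      (2 * (S.linearCoeff (circleMap 0 s t) * (circleMap 0 s t * Complex.I)).re) t :=
    (S.hasFDerivAt_log_conformalFactor hU (h t)).comp_hasDerivAt t (hasDerivAt_circleMap 0 s t)
  have hperiodic : ∫ t in 0..2 * π,
      2 * (S.linearCoeff (circleMap 0 s t) * (circleMap 0 s t * Complex.I)).re = 0 := by
    rw [intervalIntegral.integral_eq_sub_of_hasDerivAt (fun t _ => hderiv t)
      ((continuous_const.mul (Complex.continuous_re.comp hcont)).intervalIntegrable _ _)]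
    simp [circleMap]
  rw [intervalIntegral.integral_const_mul, mul_eq_zero_iff_left two_ne_zero] at hperiodic
  have hre := Complex.reCLM.intervalIntegral_comp_comm (μ := MeasureTheory.volume)
    (hcont.intervalIntegrable 0 (2 * π))
  have him := Complex.imCLM.intervalIntegral_comp_comm (μ := MeasureTheory.volume)
    (hcont.intervalIntegrable 0 (2 * π))
  simp only [Complex.reCLM_apply, Complex.imCLM_apply] at hre him
  apply Complex.ext
  · rw [← hre, hperiodic, Complex.re_ofReal_mul, Complex.I_re, mul_zero]
  · rw [← him, Complex.im_ofReal_mul, Complex.I_im, mul_one, rotationAngle]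
    simp only [← mul_assoc, Complex.mul_I_im]

theorem abs_trace_holonomy_sub_le (hU : IsOpen U) (h : ∀ t, circleMap 0 s t ∈ U) {k : ℝ}
    (hk : ∀ t, ‖circleMap 0 s t‖ * ‖S.conjCoeff (circleMap 0 s t)‖ ≤ k) :
    |LinearMap.trace ℝ ℂ (S.holonomy s h) - 2 * Real.cos (S.rotationAngle s)| ≤
      2 * (Real.exp (k * (2 * π)) - 1) := by
  have hrotation (v : ℂ) : ‖S.holonomy s h v - Complex.exp (-S.rotationAngle s * Complex.I) * v‖ ≤
      (Real.exp (k * (2 * π)) - 1) * ‖v‖ := by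
    obtain ⟨Y, rfl, hYT, hY⟩ := S.isSolutionMap_holonomy h v
    have hgronwall := norm_exp_integral_mul_sub_le
      (α := fun t => S.linearCoeff (circleMap 0 s t) * (circleMap 0 s t * Complex.I))
      (κ := fun t => S.conjCoeff (circleMap 0 s t) * conj (circleMap 0 s t * Complex.I))
      Real.two_pi_pos.le ((S.continuous_linearCoeff_circleMap h).mul
        ((continuous_circleMap 0 s).mul_const Complex.I))
      (fun t _ => by simpa [mul_comm] using hk t)
      (fun t ht => (hY t ht).congr_deriv (by
        rw [circleCoeff_eq, neg_apply, S.connection_apply (h t)]))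
    rw [S.integral_linearCoeff_mul_deriv_circleMap hU h, hYT, mul_comm ‖_‖] at hgronwall
    refine le_of_eq_of_le ?_ hgronwall
    rw [← one_mul ‖Complex.exp _ * _ - _‖,
      ← Complex.norm_exp_ofReal_mul_I (-S.rotationAngle s), ← norm_mul, mul_sub, ← mul_assoc,
      ← Complex.exp_add]
    simp
  have htrace := abs_trace_sub_two_mul_re_le hrotation
  rwa [← Complex.ofReal_neg, Complex.exp_ofReal_mul_I_re, Real.cos_neg] at htrace

theorem hasDerivAt_circleAverage_log_conformalFactor (hU : IsOpen U) (hs : s ≠ 0)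
    (h : ∀ t, circleMap 0 s t ∈ U) :
    HasDerivAt (Real.circleAverage (fun p => Real.log (S.conformalFactor p)) 0)
      (S.rotationAngle s / (π * s)) s := by
  refine (hasDerivAt_circleAverage hU
    (fun p hp => S.hasFDerivAt_log_conformalFactor hU hp) ?_ h).congr_deriv ?_
  · exact ((continuousOn_const (c := Complex.reCLM)).clm_comp
      ((ContinuousLinearMap.mul ℝ ℂ).continuous.comp_continuousOn
        S.continuousOn_linearCoeff)).const_smul (2 : ℝ)
  · have hscale (t : ℝ) : ((2 : ℝ) • Complex.reCLM ∘L
        ContinuousLinearMap.mul ℝ ℂ (S.linearCoeff (circleMap 0 s t))) (circleMap 0 1 t) =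
        2 / s * (S.linearCoeff (circleMap 0 s t) * circleMap 0 s t).re := by
      have hcircle : circleMap 0 s t = s * circleMap 0 1 t := by simp [circleMap]
      rw [hcircle, mul_left_comm, Complex.re_ofReal_mul]
      simp
      field_simp
    simp only [hscale]
    rw [intervalIntegral.integral_const_mul, smul_eq_mul, ← rotationAngle]
    field_simp

end LocalSpecialKahler

end HolonomyTrace

section Growth

variable {E : Type*} [NormedAddCommGroup E]

theorem tendsto_log_norm_nhdsNE_zero :
    Tendsto (fun x : E => Real.log ‖x‖) (𝓝[≠] 0) atBot :=
  Real.tendsto_log_nhdsGT_zero.comp tendsto_norm_nhdsNE_zero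

theorem tendsto_log_div_log_norm_of_tendsto_div {w h : E → ℝ} {C b : ℝ} (hC : C ≠ 0)
    (hlim : Tendsto (fun x => w x / h x) (𝓝[≠] 0) (𝓝 C))
    (hh : Tendsto (fun x => Real.log (h x) / Real.log ‖x‖) (𝓝[≠] 0) (𝓝 b)) :
    Tendsto (fun x => Real.log (w x) / Real.log ‖x‖) (𝓝[≠] 0) (𝓝 b) := by
  have hsum := ((hlim.log hC).div_atBot tendsto_log_norm_nhdsNE_zero).add hh
  rw [zero_add] at hsum
  refine hsum.congr' ?_
  filter_upwards [hlim.eventually_ne hC] with x hx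
  obtain ⟨-, hh⟩ := div_ne_zero_iff.1 hx
  rw [← add_div, ← Real.log_mul hx hh, div_mul_cancel₀ _ hh]

theorem tendsto_log_norm_rpow_div_log_norm (b : ℝ) :
    Tendsto (fun x : E => Real.log (‖x‖ ^ b) / Real.log ‖x‖) (𝓝[≠] 0) (𝓝 b) := by
  refine tendsto_const_nhds.congr' ?_
  filter_upwards [self_mem_nhdsWithin, tendsto_log_norm_nhdsNE_zero.eventually_lt_atBot 0]
    with x hx hlog
  rw [Real.log_rpow (norm_pos_iff.2 hx), mul_div_cancel_right₀ _ hlog.ne]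

theorem tendsto_log_norm_zpow_mul_log_div_log_norm (m : ℤ) :
    Tendsto (fun x : E => Real.log (‖x‖ ^ m * Real.log ‖x‖) / Real.log ‖x‖) (𝓝[≠] 0) (𝓝 m) := by
  have hloglog : Tendsto (fun x : E => Real.log (Real.log ‖x‖) / Real.log ‖x‖) (𝓝[≠] 0) (𝓝 0) := by
    have := (Real.isLittleO_log_id_atTop.tendsto_div_nhds_zero.comp
      (tendsto_neg_atBot_atTop.comp (tendsto_log_norm_nhdsNE_zero (E := E)))).neg
    simpa [Function.comp_def, div_neg] using this
  have hsum := hloglog.const_add (m : ℝ)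
  rw [add_zero] at hsum
  refine hsum.congr' ?_
  filter_upwards [self_mem_nhdsWithin, tendsto_log_norm_nhdsNE_zero.eventually_lt_atBot 0]
    with x hx hlog
  rw [Real.log_mul (zpow_ne_zero m (norm_ne_zero_iff.2 hx)) hlog.ne, Real.log_zpow, add_div,
    mul_div_cancel_right₀ _ hlog.ne]

theorem tendsto_norm_zpow_div_of_tendsto_div_rpow {w : E → ℝ} {C b : ℝ} {m : ℤ} (hC : C ≠ 0)
    (hb : b < m) (hlim : Tendsto (fun x => w x / ‖x‖ ^ b) (𝓝[≠] 0) (𝓝 C)) :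
    Tendsto (fun x => ‖x‖ ^ m / w x) (𝓝[≠] 0) (𝓝 0) := by
  have hpow : Tendsto (fun x : E => ‖x‖ ^ (m - b)) (𝓝[≠] 0) (𝓝 0) :=
    ((Real.continuous_rpow_const (sub_pos.2 hb).le).comp continuous_norm).tendsto' 0 0
      (by simp [(sub_pos.2 hb).ne']) |>.mono_left nhdsWithin_le_nhds
  have hquot := hpow.div hlim hC
  rw [zero_div] at hquot
  refine hquot.congr' ?_
  filter_upwards [self_mem_nhdsWithin] with x hx
  have hx := norm_pos_iff.2 hx
  have hxb := (Real.rpow_pos_of_pos hx b).ne'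
  rw [Pi.div_apply, Real.rpow_sub hx, Real.rpow_intCast, div_div_div_cancel_right₀ hxb]

theorem tendsto_norm_zpow_div_of_tendsto_div_zpow_mul_log {w : E → ℝ} {C : ℝ} {m : ℤ} (hC : C ≠ 0)
    (hlim : Tendsto (fun x => w x / (‖x‖ ^ m * Real.log ‖x‖)) (𝓝[≠] 0) (𝓝 C)) :
    Tendsto (fun x => ‖x‖ ^ m / w x) (𝓝[≠] 0) (𝓝 0) := by
  refine ((hlim.inv₀ hC).div_atBot tendsto_log_norm_nhdsNE_zero).congr' ?_
  filter_upwards [tendsto_log_norm_nhdsNE_zero.eventually_lt_atBot 0] with x hlog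
  rw [inv_div, div_right_comm, mul_div_cancel_right₀ _ hlog.ne]

end Growth

section TraceLimit

open scoped Real

namespace LocalSpecialKahler

variable {U : Set ℂ} (S : LocalSpecialKahler U) {β : ℝ}

theorem mapClusterPt_rotationAngle (hU : IsOpen U) (hU₀ : U ∈ 𝓝[≠] 0)
    (hβ : Tendsto (fun p => Real.log (S.conformalFactor p) / Real.log ‖p‖) (𝓝[≠] 0) (𝓝 β)) :
    MapClusterPt (π * β) (𝓝[>] 0) S.rotationAngle := by
  have hmem := eventually_forall_circleMap hU₀
  have hcont : ∀ᶠ p in 𝓝[≠] 0,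
      ContinuousAt (fun p => Real.log (S.conformalFactor p) / Real.log ‖p‖) p := by
    filter_upwards [hU₀, self_mem_nhdsWithin,
      tendsto_log_norm_nhdsNE_zero.eventually_lt_atBot 0] with p hp hp0 hlog
    exact (S.hasFDerivAt_log_conformalFactor hU hp).continuousAt.div
      (continuous_norm.continuousAt.log (norm_ne_zero_iff.2 hp0)) hlog.ne
  have haverage : Tendsto (fun s => Real.circleAverage
      (fun p => Real.log (S.conformalFactor p)) 0 s / Real.log s) (𝓝[>] 0) (𝓝 β) := by
    refine (tendsto_circleAverage hβ ?_).congr' ?_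
    · filter_upwards [eventually_forall_circleMap hcont] with s hs
      exact (continuous_iff_continuousAt.2 fun t =>
        (hs t).comp (continuous_circleMap 0 s).continuousAt).intervalIntegrable _ _
    · filter_upwards [self_mem_nhdsWithin] with s hs
      rw [div_eq_inv_mul, ← smul_eq_mul, ← Real.circleAverage_fun_smul]
      refine Real.circleAverage_congr_sphere fun p hp => ?_
      rw [abs_of_pos hs, mem_sphere_zero_iff_norm] at hp
      simp only [hp, smul_eq_mul, div_eq_inv_mul]
  have hcluster := mapClusterPt_mul_deriv_of_tendsto_div_log
    (hmem.and self_mem_nhdsWithin |>.mono fun s hs =>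
      S.hasDerivAt_circleAverage_log_conformalFactor hU (ne_of_gt hs.2) hs.1) haverage
  refine (hcluster.continuousAt_comp (f := (π * ·)) (by fun_prop)).congrFun ?_
  filter_upwards [self_mem_nhdsWithin] with s hs
  have hs0 : s ≠ 0 := ne_of_gt hs
  simp only [Function.comp_apply]
  field_simp

theorem tendsto_norm_mul_conjCoeff (hU₀ : U ∈ 𝓝[≠] 0)
    (hΞ : Tendsto (fun p => ‖p‖ * ‖S.cubicCoeff p‖ / S.conformalFactor p) (𝓝[≠] 0) (𝓝 0)) :
    Tendsto (fun p => ‖p‖ * ‖S.conjCoeff p‖) (𝓝[≠] 0) (𝓝 0) := by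
  have hlim := hΞ.const_mul 2
  rw [mul_zero] at hlim
  refine hlim.congr' ?_
  filter_upwards [hU₀] with p hp
  rw [eq_div_of_mul_eq (S.conformalFactor_pos hp).ne' (S.norm_conjCoeff_mul_conformalFactor hp)]
  ring

theorem tendsto_two_mul_cos_rotationAngle (hU : IsOpen U) {R r : ℝ}
    (hRU : Metric.ball 0 R \ {0} ⊆ U) (hr : r ∈ Ioo 0 R) (h : ∀ t, circleMap 0 r t ∈ U)
    (hc : Tendsto (fun p => ‖p‖ * ‖S.conjCoeff p‖) (𝓝[≠] 0) (𝓝 0)) :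
    Tendsto (fun s => 2 * Real.cos (S.rotationAngle s)) (𝓝[>] 0)
      (𝓝 (LinearMap.trace ℝ ℂ (S.holonomy r h))) := by
  have hbound : Tendsto (fun k => 2 * (Real.exp (k * (2 * π)) - 1)) (𝓝[>] 0) (𝓝 0) :=
    (Continuous.tendsto' (by fun_prop) 0 0 (by simp)).mono_left nhdsWithin_le_nhds
  refine Metric.tendsto_nhds.2 fun ε hε => ?_
  obtain ⟨k, hkε, hk⟩ := ((hbound.eventually_lt_const hε).and self_mem_nhdsWithin).exists
  filter_upwards [Ioo_mem_nhdsGT (hr.1.trans hr.2),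
    eventually_forall_circleMap (hc.eventually_le_const hk)] with s hs hsk
  have hmem := fun t => hRU (circleMap_zero_mem_ball_diff hs t)
  rw [dist_comm, Real.dist_eq, S.trace_holonomy_eq hU hRU hr hs h hmem]
  exact (S.abs_trace_holonomy_sub_le hU hmem hsk).trans_lt hkε

theorem trace_holonomy (hU : IsOpen U) {R r : ℝ} (hRU : Metric.ball 0 R \ {0} ⊆ U)
    (hr : r ∈ Ioo 0 R) (h : ∀ t, circleMap 0 r t ∈ U)
    (hβ : Tendsto (fun p => Real.log (S.conformalFactor p) / Real.log ‖p‖) (𝓝[≠] 0) (𝓝 β))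
    (hΞ : Tendsto (fun p => ‖p‖ * ‖S.cubicCoeff p‖ / S.conformalFactor p) (𝓝[≠] 0) (𝓝 0)) :
    LinearMap.trace ℝ ℂ (S.holonomy r h) = 2 * Real.cos (π * β) := by
  have hU₀ : U ∈ 𝓝[≠] 0 := mem_of_superset
    (sdiff_mem_nhdsWithin_compl (Metric.ball_mem_nhds 0 (hr.1.trans hr.2)) {0}) hRU
  have hcluster := (S.mapClusterPt_rotationAngle hU hU₀ hβ).continuousAt_comp
    (f := fun θ => 2 * Real.cos θ) (by fun_prop)
  have hlim := S.tendsto_two_mul_cos_rotationAngle hU hRU hr h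
    (S.tendsto_norm_mul_conjCoeff hU₀ hΞ)
  exact (eq_of_nhds_neBot (hcluster.clusterPt.mono hlim)).symm

end LocalSpecialKahler

end TraceLimit

section SingularExponent

namespace LocalSpecialKahler

variable {U : Set ℂ} {S : LocalSpecialKahler U} {n : ℤ} {β : ℝ}

theorem SingularExponent.tendsto_log_conformalFactor_div_log (h : S.SingularExponent n β) :
    Tendsto (fun p => Real.log (S.conformalFactor p) / Real.log ‖p‖) (𝓝[≠] 0) (𝓝 β) := by
  obtain ⟨C, hC, ⟨-, hlim⟩ | ⟨rfl, hlim⟩⟩ := h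
  · exact tendsto_log_div_log_norm_of_tendsto_div hC.ne' hlim
      (tendsto_log_norm_rpow_div_log_norm β)
  · refine tendsto_log_div_log_norm_of_tendsto_div hC.ne' hlim ?_
    simpa using tendsto_log_norm_zpow_mul_log_div_log_norm (E := ℂ) (n + 1)

theorem SingularExponent.tendsto_norm_zpow_div_conformalFactor (h : S.SingularExponent n β) :
    Tendsto (fun p => ‖p‖ ^ (n + 1) / S.conformalFactor p) (𝓝[≠] 0) (𝓝 0) := by
  obtain ⟨C, hC, ⟨hβ, hlim⟩ | ⟨-, hlim⟩⟩ := h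
  · exact tendsto_norm_zpow_div_of_tendsto_div_rpow hC.ne' (by exact_mod_cast hβ) hlim
  · refine tendsto_norm_zpow_div_of_tendsto_div_zpow_mul_log (neg_ne_zero.2 hC.ne') ?_
    simpa [div_neg] using hlim.neg

theorem SingularExponent.tendsto_norm_mul_cubicCoeff_div_conformalFactor
    (h : S.SingularExponent n β) (hn : S.CubicOrderEq n) :
    Tendsto (fun p => ‖p‖ * ‖S.cubicCoeff p‖ / S.conformalFactor p) (𝓝[≠] 0) (𝓝 0) := by
  obtain ⟨G, hG, -, hGeq⟩ := (meromorphicOrderAt_eq_int_iff hn.1).1 hn.2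
  have hlim := (hG.continuousAt.norm.tendsto.mono_left nhdsWithin_le_nhds).mul
    h.tendsto_norm_zpow_div_conformalFactor
  rw [mul_zero] at hlim
  refine hlim.congr' ?_
  filter_upwards [self_mem_nhdsWithin, hGeq] with p hp hGp
  rw [hGp, sub_zero, norm_smul, norm_zpow, zpow_add_one₀ (norm_ne_zero_iff.2 hp)]
  ring

end LocalSpecialKahler

end SingularExponent

section Cosine

open scoped Real

theorem exists_eq_intCast_div_iff_sin_eq_zero {m : ℕ} (hm : m ≠ 0) (β : ℝ) :
    (∃ k : ℤ, β = k / m) ↔ Real.sin (m * (π * β)) = 0 := by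
  have hm' : (m : ℝ) ≠ 0 := Nat.cast_ne_zero.2 hm
  rw [Real.sin_eq_zero_iff]
  refine exists_congr fun k => ?_
  rw [eq_div_iff hm', mul_left_comm, mul_comm β, mul_comm (k : ℝ), eq_comm,
    mul_right_inj' Real.pi_ne_zero]

theorem halfInt_or_thirdInt_iff_cos_mem (β : ℝ) :
    ((∃ k : ℤ, β = k / 2) ∨ ∃ k : ℤ, β = k / 3) ↔
      Real.cos (π * β) ∈ ({0, 1 / 2, -(1 / 2), 1, -1} : Set ℝ) := by
  have h₂ := exists_eq_intCast_div_iff_sin_eq_zero two_ne_zero β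
  have h₃ := exists_eq_intCast_div_iff_sin_eq_zero three_ne_zero β
  push_cast at h₂ h₃
  rw [h₂, h₃]
  generalize π * β = x
  have hsin₂ : Real.sin (2 * x) = 2 * (Real.sin x * Real.cos x) := by
    rw [Real.sin_two_mul, mul_assoc]
  have hsin₃ : Real.sin (3 * x) =
      4 * (Real.sin x * ((Real.cos x - 1 / 2) * (Real.cos x + 1 / 2))) := by
    rw [Real.sin_three_mul]
    linear_combination -4 * Real.sin x * Real.sin_sq_add_cos_sq x
  simp only [hsin₂, hsin₃, mul_eq_zero, two_ne_zero, four_ne_zero, false_or,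
    Real.sin_eq_zero_iff_cos_eq, sub_eq_zero, add_eq_zero_iff_eq_neg, mem_insert_iff,
    mem_singleton_iff]
  tauto

theorem exists_two_mul_cos_eq_intCast_iff (x : ℝ) :
    (∃ k : ℤ, 2 * Real.cos x = k) ↔ Real.cos x ∈ ({0, 1 / 2, -(1 / 2), 1, -1} : Set ℝ) := by
  simp only [mem_insert_iff, mem_singleton_iff]
  constructor
  · rintro ⟨k, hk⟩
    have hk₂ : k ≤ 2 := by
      exact_mod_cast (by linarith [Real.cos_le_one x] : (k : ℝ) ≤ 2)
    have hk₂' : -2 ≤ k := by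
      exact_mod_cast (by linarith [Real.neg_one_le_cos x] : (-2 : ℝ) ≤ k)
    rw [mul_comm, ← eq_div_iff two_ne_zero] at hk
    rw [hk]
    interval_cases k <;> norm_num
  · rintro (h | h | h | h | h) <;> rw [h]
    exacts [⟨0, by norm_num⟩, ⟨1, by norm_num⟩, ⟨-1, by norm_num⟩, ⟨2, by norm_num⟩,
      ⟨-2, by norm_num⟩]

end Cosine

theorem mainTheorem4_general {U : Set ℂ} (hU : IsOpen U) (S : LocalSpecialKahler U) {R r : ℝ}
    (hRU : Metric.ball 0 R \ {0} ⊆ U) (hr : r ∈ Ioo 0 R) (h : ∀ t, circleMap 0 r t ∈ U) {β : ℝ}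
    (hβ : Tendsto (fun p => Real.log (S.conformalFactor p) / Real.log ‖p‖) (𝓝[≠] 0) (𝓝 β))
    (hΞ : Tendsto (fun p => ‖p‖ * ‖S.cubicCoeff p‖ / S.conformalFactor p) (𝓝[≠] 0) (𝓝 0)) :
    [ IsSymplecticallyConjToIntegral (S.kahlerForm r) (S.holonomy r h),
      IsConjToIntegral (S.holonomy r h),
      (∃ k : ℤ, β = (k : ℝ) / 2) ∨ (∃ k : ℤ, β = (k : ℝ) / 3),
      Real.cos (Real.pi * β) ∈ ({0, 1 / 2, -(1 / 2), 1, -1} : Set ℝ) ].TFAE := by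
  have htrace := S.trace_holonomy hU hRU hr h hβ hΞ
  have hrU : (r : ℂ) ∈ U := by simpa [circleMap] using h 0
  tfae_have 1 → 2 := IsSymplecticallyConjToIntegral.isConjToIntegral
  tfae_have 2 → 4 := fun hP =>
    (exists_two_mul_cos_eq_intCast_iff _).1 (htrace ▸ hP.exists_trace_eq_intCast)
  tfae_have 4 → 1 := fun hcos =>
    have ⟨_, hk⟩ := (exists_two_mul_cos_eq_intCast_iff _).2 hcos
    isSymplecticallyConjToIntegral_of_trace_eq_intCast (S.isAlt_kahlerForm hrU)
      (S.separatingLeft_kahlerForm hrU) (S.kahlerForm_holonomy hU h) (htrace.trans hk)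
  tfae_have 3 ↔ 4 := halfInt_or_thirdInt_iff_cos_mem β
  tfae_finish

theorem target_inter_preimage_compl_eq_diff {X Y : Type*} [TopologicalSpace X] [TopologicalSpace Y]
    {e : OpenPartialHomeomorph X Y} {x : X} (hx : x ∈ e.source) :
    e.target ∩ e.symm ⁻¹' {x}ᶜ = e.target \ {e x} := by
  ext y
  refine and_congr_right fun hy => not_congr ?_
  rw [mem_singleton_iff, mem_singleton_iff, eq_comm, e.eq_symm_apply hx hy, eq_comm]

theorem exists_ball_subset_of_closedBall_subset {E : Type*} [NormedAddCommGroup E] [NormedSpace ℝ E]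
    [ProperSpace E] {x : E} {r : ℝ} {V : Set E} (hr : 0 ≤ r) (hV : IsOpen V)
    (h : Metric.closedBall x r ⊆ V) : ∃ R > r, Metric.ball x R ⊆ V := by
  obtain ⟨δ, hδ, hthick⟩ := (isCompact_closedBall x r).exists_thickening_subset_open hV h
  rw [thickening_closedBall hδ hr] at hthick
  exact ⟨δ + r, lt_add_of_pos_left r hδ, hthick⟩

theorem mainTheorem4 {M : Type*} [TopologicalSpace M] [ChartedSpace ℂ M] [IsManifold 𝓘(ℂ) ω M]
    (m₀ : M) (S : SpecialKahlerStructure M {m₀}ᶜ)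
    (z : OpenPartialHomeomorph M ℂ) (hz : z ∈ IsManifold.maximalAtlas 𝓘(ℂ) ω M)
    (hm : m₀ ∈ z.source) (hz₀ : z m₀ = 0)
    (n : ℤ) (hn : (S.inChart z hz).CubicOrderEq n)
    (β : ℝ) (hβ : (S.inChart z hz).SingularExponent n β)
    (r : ℝ) (hr : 0 < r) (hball : Metric.closedBall 0 r ⊆ z.target) :
    [ IsSymplecticallyConjToIntegral ((S.inChart z hz).kahlerForm (r : ℂ))
        ((S.inChart z hz).holonomy r (circle_mem_punctured hz₀ hr hball)),
      IsConjToIntegral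
        ((S.inChart z hz).holonomy r (circle_mem_punctured hz₀ hr hball)),
      (∃ k : ℤ, β = (k : ℝ) / 2) ∨ (∃ k : ℤ, β = (k : ℝ) / 3),
      Real.cos (Real.pi * β) ∈ ({0, 1 / 2, -(1 / 2), 1, -1} : Set ℝ) ].TFAE := by
  obtain ⟨R, hrR, hR⟩ := exists_ball_subset_of_closedBall_subset hr.le z.open_target hball
  have hpunctured := hz₀ ▸ target_inter_preimage_compl_eq_diff hm
  exact mainTheorem4_general (hpunctured ▸ z.open_target.sdiff isClosed_singleton) _
    (hpunctured ▸ sdiff_subset_sdiff_left hR) ⟨hr, hrR⟩ _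
    hβ.tendsto_log_conformalFactor_div_log
    (hβ.tendsto_norm_mul_cubicCoeff_div_conformalFactor hn)
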